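/- **Setting.** Let $\Theta\subset\mathbb R^d$ be compact, $\pi_0$ a probability measure on $\Theta$, $T\ge 1$, and let $G_t:\Theta\to(0,\infty)$, $1\le t\le T$, be bounded (measurable) potentials. Define probability measures on $\Theta$ by $$\pi_t(\mathrm d\theta)=\frac{G_t(\theta)\,\pi_{t-1}(\mathrm d\theta)}{\int_\Theta G_t\,\mathrm d\pi_{t-1}},\qquad 1\le t\le T .$$ For each $N\ge1$ let $\kappa_N$ be a Markov kernel on $\Theta$ such that, for a constant $c_\kappa<\infty$ independent of $N$ and of $\varphi$, $\sup_{\theta'\in\Theta}\int_\Theta|\varphi(\theta)-\varphi(\theta')|\,\kappa_N(\mathrm d\theta|\theta')\le c_\kappa\|\varphi\|_\infty/\sqrt N$ for all bounded measurable $\varphi:\Theta\to\mathbb R$. For every $N\ge 1$ let $(\theta_t^{(i)})_{1\le i\le N,\,0\le t\le T}$ be the $N$-particle system generated as follows (for all $N$ on one probability space; no relation between the systems for different $N$ is assumed). Draw $\theta_0^{(i)}$, $i=1,\dots,N$, i.i.d. from $\pi_0$. For $t=1,\dots,T$: given the past, draw independently $\hat\theta_t^{(i)}\sim\kappa_N(\cdot|\theta_{t-1}^{(i)})$,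 $i=1,\dots,N$; put $w_t^{(i)}=G_t(\hat\theta_t^{(i)})/\sum_{j=1}^N G_t(\hat\theta_t^{(j)})$; given the past and the $\hat\theta_t^{(j)}$, draw $\theta_t^{(i)}$, $i=1,\dots,N$, i.i.d. from $\sum_{j=1}^N w_t^{(j)}\delta_{\hat\theta_t^{(j)}}$. For $\alpha\in\{0,1\}^d$ write $\mathsf D^\alpha=\partial_1^{\alpha_1}\cdots\partial_d^{\alpha_d}$. Let $\mathsf k:\mathbb R^d\to[0,\infty)$ be a probability density with zero mean and finite second moment whose derivatives $\mathsf D^\alpha\mathsf k$, $\alpha\in\{0,1\}^d$, exist and are continuous and bounded. Put $h=\lfloor N^{1/(2(d+1))}\rfloor^{-1}$, $\mathsf k_h(\theta)=h^{-d}\mathsf k(h^{-1}\theta)$, and define the particle kernel density estimator $$\mathsf p_t^N(\theta)=\frac1N\sum_{i=1}^N\mathsf k_h\big(\theta-\theta_t^{(i)}\big).$$ **Theorem.** Assume that, for $1\le t\le T$, $\pi_t$ has a density with respect to Lebesgue measure on $\Theta$, again denoted $\pi_t:\Theta\to[0,\infty)$, such that for every $\alpha\in\{0,1\}^d$ the derivative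 $\mathsf D^\alpha\pi_t$ exists on $\Theta$ (taken within $\Theta$ at boundary points) and is Lipschitz continuous on $\Theta$. Let $1\le t\le T$, let $\theta_t^\star\in\operatorname{argmax}_{\theta\in\Theta}\pi_t(\theta)$ lie in the interior of $\Theta$, and let $\varepsilon\in(0,1)$. Then there are an almost surely finite random variable $W_{t,d,\varepsilon}$, independent of $N$, and an integer $N_0$ such that, almost surely, for all $N\ge N_0$ and for every particle $\theta_t^{\star,N}\in\{\theta_t^{(1)},\dots,\theta_t^{(N)}\}$ that maximizes $\mathsf p_t^N$ over $\{\theta_t^{(1)},\dots,\theta_t^{(N)}\}$, $$\pi_t(\theta_t^\star)-\pi_t(\theta_t^{\star,N})\le\frac{W_{t,d,\varepsilon}}{N^{\frac{1-\varepsilon}{2(d+1)}}}.$$ -/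

import Mathlib

open MeasureTheory ProbabilityTheory Filter
open scoped ENNReal

noncomputable section

/-- The probability measures `π_t(dx) = π_{t-1}(dx) G_t(x) / ∫ G_t dπ_{t-1}`, started at `π₀`. -/
def potentialFlow {S : Type*} [MeasurableSpace S] (π₀ : Measure S) (G : ℕ → S → ℝ) : ℕ → Measure S
  | 0 => π₀
  | t + 1 =>
    (∫⁻ x, ENNReal.ofReal (G (t + 1) x) ∂(potentialFlow π₀ G t))⁻¹ •
      (potentialFlow π₀ G t).withDensity (fun x => ENNReal.ofReal (G (t + 1) x))

/-- The normalized weights `w^(i) = g(x^(i)) / ∑ j, g(x^(j))`. -/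
def weight {S : Type*} {N : ℕ} (g : S → ℝ) (x : Fin N → S) (i : Fin N) : ℝ :=
  g (x i) / ∑ j, g (x j)

/-- The σ-algebra generated by the particles `X s i`, `0 ≤ s ≤ t`, and the jittered particles
`Y s i`, `1 ≤ s ≤ t`. -/
abbrev particleHistory {S Ω : Type*} [MeasurableSpace S] {N : ℕ}
    (X Y : ℕ → Fin N → Ω → S) (t : ℕ) : MeasurableSpace Ω :=
  (⨆ s ∈ Set.Iic t, ⨆ i, MeasurableSpace.comap (X s i) inferInstance) ⊔
    (⨆ s ∈ Set.Icc 1 t, ⨆ i, MeasurableSpace.comap (Y s i) inferInstance)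

/-- `X t i` (particles after resampling, `0 ≤ t ≤ T`) and `Y t i` (jittered particles,
`1 ≤ t ≤ T`) are produced by the `N`-particle sampler with prior `π₀`, jittering kernel `κ` and
potentials `G` (indexed from `1`), run for `T` steps on the probability space `(Ω, P)`. -/
structure IsParticleSystem {S Ω : Type*} [MeasurableSpace S] [MeasurableSpace Ω]
    (P : Measure Ω) (π₀ : Measure S) (κ : Kernel S S) (G : ℕ → S → ℝ) (T N : ℕ)
    (X Y : ℕ → Fin N → Ω → S) : Prop where
  measurable_X : ∀ t i, Measurable (X t i)
  measurable_Y : ∀ t i, Measurable (Y t i)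
  /-- The initial particles are i.i.d. with law `π₀`. -/
  init : P.map (fun ω i => X 0 i ω) = Measure.pi (fun _ => π₀)
  /-- Jittering: given the past, the `Y (t + 1) i` are independent with laws `κ (X t i)`. -/
  jitter : ∀ t < T, ∀ B : Fin N → Set S, (∀ i, MeasurableSet (B i)) →
    P[(⋂ i, Y (t + 1) i ⁻¹' B i).indicator (fun _ => (1 : ℝ)) | particleHistory X Y t]
      =ᵐ[P] fun ω => ∏ i, (κ (X t i ω)).real (B i)
  /-- Weighting and multinomial resampling: given the past and the `Y (t + 1) j`, the
  `X (t + 1) i` are i.i.d. with law `∑ j, w^(j) δ_{Y (t + 1) j}`. -/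
  resample : ∀ t < T, ∀ B : Fin N → Set S, (∀ i, MeasurableSet (B i)) →
    P[(⋂ i, X (t + 1) i ⁻¹' B i).indicator (fun _ => (1 : ℝ)) |
        particleHistory X Y t ⊔ ⨆ i, MeasurableSpace.comap (Y (t + 1) i) inferInstance]
      =ᵐ[P] fun ω => ∏ i, ∑ j,
        weight (G (t + 1)) (fun l => Y (t + 1) l ω) j *
          (B i).indicator (fun _ => (1 : ℝ)) (Y (t + 1) j ω)

/-- The condition on the jittering kernels (one Markov kernel `κ N` for each particle number `N`):
`sup_{x'} ∫ |φ(x) - φ(x')| κ_N(dx | x') ≤ c ‖φ‖_∞ / √N` for all bounded measurable `φ`,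
with `c` independent of `N` and `φ`. -/
def JitterBound {S : Type*} [MeasurableSpace S] (κ : ℕ → Kernel S S) : Prop :=
  ∃ c : ℝ, ∀ N : ℕ, 1 ≤ N → ∀ φ : S → ℝ, Measurable φ → BddAbove (Set.range fun x => |φ x|) →
    ∀ x' : S, ∫ x, |φ x - φ x'| ∂(κ N x') ≤ c * (⨆ x, |φ x|) / √(N : ℝ)

/-- The potentials `G_t`, `1 ≤ t ≤ T`, are measurable, positive and bounded. -/
def PositiveBoundedPotentials {S : Type*} [MeasurableSpace S] (G : ℕ → S → ℝ) (T : ℕ) : Prop :=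
  ∀ t, 1 ≤ t → t ≤ T → Measurable (G t) ∧ (∀ x, 0 < G t x) ∧ BddAbove (Set.range (G t))

/-- `D A` is, on `s`, the mixed partial derivative `D^α f` for the multi-index `α ∈ {0,1}^d` with
support `A`: the innermost derivative is the one with the largest index, so that `D^α` with
smallest index `i` in its support is the partial derivative in direction `e_i` of `D^(α - e_i)`.
At points that are not interior to `s`, derivatives are taken within `s`. -/
structure IsMixedPartials {d : ℕ} (s : Set (EuclideanSpace ℝ (Fin d)))
    (f : EuclideanSpace ℝ (Fin d) → ℝ)
    (D : Finset (Fin d) → EuclideanSpace ℝ (Fin d) → ℝ) : Prop where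
  zero : ∀ x ∈ s, D ∅ x = f x
  step : ∀ (A : Finset (Fin d)) (i : Fin d), (∀ j ∈ A, i < j) → ∀ x ∈ s,
    HasLineDerivWithinAt ℝ (D A) (D (insert i A) x) s x (EuclideanSpace.single i 1)

/-- All derivatives `D^α f`, `α ∈ {0,1}^d`, exist on `s` and are Lipschitz continuous there. -/
def HasLipschitzMixedPartials {d : ℕ} (s : Set (EuclideanSpace ℝ (Fin d)))
    (f : EuclideanSpace ℝ (Fin d) → ℝ) : Prop :=
  ∃ D : Finset (Fin d) → EuclideanSpace ℝ (Fin d) → ℝ, IsMixedPartials s f D ∧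
    ∀ A, ∃ L : ℝ, ∀ x ∈ s, ∀ y ∈ s, |D A x - D A y| ≤ L * ‖x - y‖

/-- `p` is a probability density of `μ`, a measure on `Θ`, with respect to Lebesgue measure
on `Θ`; only the values of `p` on `Θ` matter. -/
def IsLebesgueDensity {d : ℕ} {Θ : Set (EuclideanSpace ℝ (Fin d))} (μ : Measure Θ)
    (p : EuclideanSpace ℝ (Fin d) → ℝ) : Prop :=
  (∀ x ∈ Θ, 0 ≤ p x) ∧
    μ = (Measure.comap ((↑) : Θ → EuclideanSpace ℝ (Fin d)) volume).withDensity
      (fun x => ENNReal.ofReal (p x))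

/-- Kernels for density estimation: a probability density on `ℝ^d` with zero mean and finite second
moment, whose derivatives `D^α k`, `α ∈ {0,1}^d`, exist and are continuous and bounded. -/
structure IsRegularKernel {d : ℕ} (k : EuclideanSpace ℝ (Fin d) → ℝ) : Prop where
  nonneg : ∀ x, 0 ≤ k x
  integrable : Integrable k volume
  integral_eq_one : ∫ x, k x = 1
  second_moment : Integrable (fun x => ‖x‖ ^ 2 * k x) volume
  zero_mean : ∫ x, k x • x = 0
  mixed_partials : ∃ D : Finset (Fin d) → EuclideanSpace ℝ (Fin d) → ℝ,
    IsMixedPartials Set.univ k D ∧ ∀ A, Continuous (D A) ∧ ∃ C : ℝ, ∀ x, |D A x| ≤ C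

/-- The bandwidth `h = ⌊N^(1/(2(d+1)))⌋⁻¹`. -/
def bandwidth (d N : ℕ) : ℝ :=
  ((⌊(N : ℝ) ^ ((1 : ℝ) / (2 * ((d : ℝ) + 1)))⌋₊ : ℕ) : ℝ)⁻¹

/-- The scaled kernel `k_h(x) = h^(-d) k(h⁻¹ x)`. -/
def scaledKernel {d : ℕ} (k : EuclideanSpace ℝ (Fin d) → ℝ) (h : ℝ)
    (x : EuclideanSpace ℝ (Fin d)) : ℝ :=
  (h ^ d)⁻¹ * k (h⁻¹ • x)

/-- The kernel density estimator `(1/N) ∑ i, k_h(y - x^(i))` with bandwidth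
`h = ⌊N^(1/(2(d+1)))⌋⁻¹`. -/
def particleKDE {d N : ℕ} (k : EuclideanSpace ℝ (Fin d) → ℝ)
    (x : Fin N → EuclideanSpace ℝ (Fin d)) (y : EuclideanSpace ℝ (Fin d)) : ℝ :=
  (1 / (N : ℝ)) * ∑ i, scaledKernel k (bandwidth d N) (y - x i)

end

/-! Write `u = N ^ ρ` with `ρ = 1 / (2 (d + 1))`, so that `u ^ (d + 1) = √N` and the bandwidth is of
order `1 / u`. A smoothed Lipschitz density has bias `O(1 / u)`, and an empirical average with error
`N ^ δ / √N`, once multiplied by `h ^ (-d)`, contributes `u ^ d * N ^ δ / √N = N ^ δ / u`. With `δ =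
ε ρ` both are `O(N ^ (-(1 - ε) ρ))`, the claimed rate.

The stochastic input is `HasEmpiricalTails`: averages of bounded test functions over the particles
have errors of order `N ^ (-1/2)`, with tails of every polynomial order. This passes from one time
to the next. Jittering costs a conditional Hoeffding term and a bias `O(N ^ (-1/2))`; resampling
costs another Hoeffding term and the perturbation of a ratio of averages
(`HasEmpiricalTails.jitter`, `HasEmpiricalTails.resample`).

Since the tails beat every power of `N`, a union bound over a grid with polynomially many points
controls the estimator at all grid points, and the Lipschitz bound on the kernel extends this to all
of `Θ` (`abs_particleKDE_sub_le`). One more test function, the indicator of a ball of radius `N ^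
(-(1 - ε) ρ)` about the mode, shows that some particle lies in that ball. The maximizing particle
has an estimated density at least as large as that of this nearby particle, hence nearly the largest
true density (`sub_le_of_isMax_particleKDE`).

The exceptional events have probability `O(N ^ (-3))`. On them the gap is at most the maximum of the
density, and a single random series with finite mean absorbs them all (`exists_random_bound`). This
is why the threshold on `N` can be deterministic. -/

/-! ### Hoeffding's inequality, unconditional and conditional -/

/-- **Hoeffding's inequality** for a product of probability measures. -/
theorem measureReal_pi_abs_sum_ge_le {S : Type*} [MeasurableSpace S] {N : ℕ}
    (μ : Fin N → Measure S) [∀ i, IsProbabilityMeasure (μ i)] {φ : S → ℝ} (hφ : Measurable φ)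
    (hφ1 : ∀ x, |φ x| ≤ 1) {a : ℝ} (ha : 0 ≤ a) :
    (Measure.pi μ).real {y | a ≤ |∑ i, (φ (y i) - ∫ x, φ x ∂μ i)|} ≤
      2 * Real.exp (-a ^ 2 / (2 * N)) := by
  have main : ∀ ψ : S → ℝ, Measurable ψ → (∀ x, |ψ x| ≤ 1) →
      (Measure.pi μ).real {y | a ≤ ∑ i, (ψ (y i) - ∫ x, ψ x ∂μ i)} ≤
        Real.exp (-a ^ 2 / (2 * N)) := by
    intro ψ hψ hψ1
    have hind : iIndepFun (fun i (y : Fin N → S) => ψ (y i) - ∫ x, ψ x ∂μ i) (Measure.pi μ) :=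
      iIndepFun_pi (X := fun i x => ψ x - ∫ x, ψ x ∂μ i)
        (fun i => (hψ.sub_const _).aemeasurable)
    have hsub : ∀ i ∈ (Finset.univ : Finset (Fin N)),
        HasSubgaussianMGF (fun y : Fin N → S => ψ (y i) - ∫ x, ψ x ∂μ i) 1 (Measure.pi μ) := by
      intro i _
      -- Hoeffding's lemma on an interval of length `2` gives the variance proxy `(2 / 2) ^ 2 = 1`.
      have h := hasSubgaussianMGF_of_mem_Icc (X := fun y : Fin N → S => ψ (y i))
        (μ := Measure.pi μ) (a := -1) (b := 1) (hψ.comp (measurable_pi_apply i)).aemeasurable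
        (ae_of_all _ fun y => abs_le.1 (hψ1 (y i)))
      have e : ∫ y, ψ (y i) ∂(Measure.pi μ) = ∫ x, ψ x ∂μ i :=
        integral_comp_eval (μ := μ) hψ.aestronglyMeasurable
      rw [e] at h
      convert h using 1
      ext
      norm_num
    have h := HasSubgaussianMGF.measure_sum_ge_le_of_iIndepFun hind hsub ha
    simpa using h
  have h1 := main φ hφ hφ1
  have h2 := main (fun x => -φ x) hφ.neg (by simpa using hφ1)
  have hsub : {y : Fin N → S | a ≤ |∑ i, (φ (y i) - ∫ x, φ x ∂μ i)|} ⊆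
      {y | a ≤ ∑ i, (φ (y i) - ∫ x, φ x ∂μ i)} ∪
        {y | a ≤ ∑ i, (-φ (y i) - ∫ x, -φ x ∂μ i)} := by
    intro y hy
    rcases le_abs.1 (show a ≤ |_| from hy) with h | h
    · exact Or.inl h
    · right
      simp only [Set.mem_ofPred_eq, integral_neg]
      rw [← Finset.sum_neg_distrib] at h
      refine h.trans_eq (Finset.sum_congr rfl fun i _ => by ring)
  calc _ ≤ _ := measureReal_mono hsub
    _ ≤ _ := measureReal_union_le _ _
    _ ≤ _ := by linarith

theorem measurable_measure_pi {E S : Type*} [MeasurableSpace E] [MeasurableSpace S] {N : ℕ}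
    (η : Fin N → Kernel E S) [∀ i, IsMarkovKernel (η i)] :
    Measurable fun u => Measure.pi fun i => η i u := by
  refine Measurable.measure_of_isPiSystem_of_isProbabilityMeasure generateFrom_pi.symm
    isPiSystem_pi ?_
  rintro _ ⟨B, hB, rfl⟩
  simp only [Measure.pi_pi]
  exact Finset.measurable_prod _ fun i _ => (η i).measurable_coe (hB i (Set.mem_univ i))

/-- If, conditionally on `m`, the `V i` are independent with laws `η i U`, then the law of `(U, V)`
is the composition of the law of `U` with the product kernel. -/
theorem map_prodMk_eq_compProd_pi {Ω E S : Type*} {m : MeasurableSpace Ω}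
    [mΩ : MeasurableSpace Ω] [MeasurableSpace E]
    [MeasurableSpace S] {N : ℕ} (P : Measure Ω) [IsProbabilityMeasure P] (hm : m ≤ mΩ)
    {U : Ω → E} (hU : Measurable[m] U) {V : Fin N → Ω → S}
    (hV : ∀ i, Measurable (V i)) (η : Fin N → Kernel E S) [∀ i, IsMarkovKernel (η i)]
    (h : ∀ B : Fin N → Set S, (∀ i, MeasurableSet (B i)) →
      P[(⋂ i, V i ⁻¹' B i).indicator (fun _ => (1 : ℝ)) | m]
        =ᵐ[P] fun ω => ∏ i, (η i (U ω)).real (B i)) :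
    P.map (fun ω => (U ω, fun i => V i ω)) =
      (P.map U).compProd ⟨fun u => Measure.pi fun i => η i u, measurable_measure_pi η⟩ := by
  have hU' : Measurable U := hU.mono hm le_rfl
  have hV' : Measurable fun ω i => V i ω := measurable_pi_lambda _ hV
  set K : Kernel E (Fin N → S) := ⟨fun u => Measure.pi fun i => η i u, measurable_measure_pi η⟩
    with hK
  have : IsMarkovKernel K := ⟨fun u => by
    change IsProbabilityMeasure (Measure.pi fun i => η i u); infer_instance⟩
  have : IsProbabilityMeasure (P.map U) := Measure.isProbabilityMeasure_map hU'.aemeasurable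
  have : IsProbabilityMeasure (P.map (fun ω => (U ω, fun i => V i ω))) :=
    Measure.isProbabilityMeasure_map (hU'.prodMk hV').aemeasurable
  refine Measure.ext_prod fun {s t} hs ht => ?_
  rw [Measure.compProd_apply_prod hs ht, Measure.map_apply (hU'.prodMk hV') (hs.prod ht),
    setLIntegral_map hs (K.measurable_coe ht) hU']
  have hKU : AEMeasurable (fun ω => K (U ω)) (P.restrict (U ⁻¹' s)) :=
    (K.measurable.comp hU').aemeasurable
  -- For a fixed event `U ∈ s`, which belongs to `m`, the two finite measures agree on boxes by the
  -- defining property of conditional expectation, hence everywhere by a π-λ argument.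
  have key : (P.restrict (U ⁻¹' s)).map (fun ω i => V i ω) =
      (P.restrict (U ⁻¹' s)).bind (fun ω => K (U ω)) := by
    refine ext_of_generate_finite _ generateFrom_pi.symm isPiSystem_pi ?_ ?_
    · rintro _ ⟨B, hB, rfl⟩
      have hB' : ∀ i, MeasurableSet (B i) := fun i => hB i (Set.mem_univ i)
      have hpre : (fun ω i => V i ω) ⁻¹' (Set.univ.pi B) = ⋂ i, V i ⁻¹' B i := by
        ext ω; simp
      have hmeas : MeasurableSet (⋂ i, V i ⁻¹' B i) :=
        MeasurableSet.iInter fun i => hV i (hB' i)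
      rw [Measure.map_apply hV' (MeasurableSet.univ_pi hB'), hpre,
        Measure.bind_apply (MeasurableSet.univ_pi hB') hKU]
      have e1 := setIntegral_condExp hm
        (f := (⋂ i, V i ⁻¹' B i).indicator (fun _ => (1 : ℝ))) (μ := P)
        ((integrable_const _).indicator hmeas) (hU hs)
      rw [setIntegral_congr_ae (hm _ (hU hs)) ((h B hB').mono fun x hx _ => hx),
        integral_indicator_const _ hmeas] at e1
      have e2 : ∀ ω, K (U ω) (Set.univ.pi B) =
          ENNReal.ofReal (∏ i, (η i (U ω)).real (B i)) := by
        intro ω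
        change Measure.pi (fun i => η i (U ω)) (Set.univ.pi B) = _
        rw [Measure.pi_pi, ENNReal.ofReal_prod_of_nonneg fun _ _ => measureReal_nonneg]
        simp
      have hmr : Measurable fun ω => ∏ i, (η i (U ω)).real (B i) :=
        Finset.measurable_prod _ fun i _ =>
          (((η i).measurable_coe (hB' i)).comp hU').ennreal_toReal
      simp_rw [e2]
      rw [← ofReal_integral_eq_lintegral_ofReal, e1]
      · simp
      · refine Integrable.of_bound hmr.aestronglyMeasurable 1 (ae_of_all _ fun ω => ?_)
        rw [Real.norm_of_nonneg (Finset.prod_nonneg fun _ _ => measureReal_nonneg)]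
        exact Finset.prod_le_one (fun _ _ => measureReal_nonneg) fun _ _ => measureReal_le_one
      · exact ae_of_all _ fun ω => Finset.prod_nonneg fun _ _ => measureReal_nonneg
    · rw [Measure.map_apply hV' MeasurableSet.univ, Measure.bind_apply MeasurableSet.univ hKU]
      simp
  have h2 := congrArg (fun ν => ν t) key
  rw [Measure.map_apply hV' ht, Measure.bind_apply ht hKU,
    Measure.restrict_apply (hV' ht)] at h2
  rw [← h2]
  congr 1
  ext ω
  simp [and_comm]

/-- **Hoeffding's inequality** for conditionally independent random variables. -/
theorem measureReal_abs_sum_ge_le_of_condIndep {Ω E S : Type*} {m : MeasurableSpace Ω}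
    [mΩ : MeasurableSpace Ω]
    [MeasurableSpace E]
    [MeasurableSpace S] {N : ℕ} (P : Measure Ω) [IsProbabilityMeasure P] (hm : m ≤ mΩ)
    {U : Ω → E} (hU : Measurable[m] U) {V : Fin N → Ω → S}
    (hV : ∀ i, Measurable (V i)) (η : Fin N → Kernel E S) [∀ i, IsMarkovKernel (η i)]
    (h : ∀ B : Fin N → Set S, (∀ i, MeasurableSet (B i)) →
      P[(⋂ i, V i ⁻¹' B i).indicator (fun _ => (1 : ℝ)) | m]
        =ᵐ[P] fun ω => ∏ i, (η i (U ω)).real (B i))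
    {φ : S → ℝ} (hφ : Measurable φ) (hφ1 : ∀ x, |φ x| ≤ 1) {a : ℝ} (ha : 0 ≤ a) :
    P.real {ω | a ≤ |∑ i, (φ (V i ω) - ∫ x, φ x ∂η i (U ω))|} ≤
      2 * Real.exp (-a ^ 2 / (2 * N)) := by
  have hU' : Measurable U := hU.mono hm le_rfl
  have hV' : Measurable fun ω i => V i ω := measurable_pi_lambda _ hV
  have hmap := map_prodMk_eq_compProd_pi P hm hU hV η h
  set K : Kernel E (Fin N → S) := ⟨fun u => Measure.pi fun i => η i u, measurable_measure_pi η⟩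
    with hK
  have : IsMarkovKernel K := ⟨fun u => by
    change IsProbabilityMeasure (Measure.pi fun i => η i u); infer_instance⟩
  have : IsProbabilityMeasure (P.map U) := Measure.isProbabilityMeasure_map hU'.aemeasurable
  set D : Set (E × (Fin N → S)) := {z | a ≤ |∑ i, (φ (z.2 i) - ∫ x, φ x ∂η i z.1)|} with hD
  have hDm : MeasurableSet D := by
    refine measurableSet_le measurable_const (Measurable.abs ?_)
    refine Finset.measurable_sum _ fun i _ => ?_
    refine (hφ.comp ((measurable_pi_apply i).comp measurable_snd)).sub ?_
    exact (hφ.stronglyMeasurable.integral_kernel (κ := η i)).measurable.comp measurable_fst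
  have hpre : {ω | a ≤ |∑ i, (φ (V i ω) - ∫ x, φ x ∂η i (U ω))|} =
      (fun ω => (U ω, fun i => V i ω)) ⁻¹' D := rfl
  rw [hpre, ← map_measureReal_apply (hU'.prodMk hV') hDm, hmap]
  refine ENNReal.toReal_le_of_le_ofReal (by positivity) ?_
  rw [Measure.compProd_apply hDm]
  -- Each fibre over `u` carries a product measure, so the unconditional inequality applies with a
  -- bound that does not depend on `u`.
  calc _ ≤ ∫⁻ _, ENNReal.ofReal (2 * Real.exp (-a ^ 2 / (2 * N))) ∂(P.map U) := by
        refine lintegral_mono fun u => ?_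
        rw [← ENNReal.ofReal_toReal (measure_ne_top (K u) _)]
        refine ENNReal.ofReal_le_ofReal ?_
        exact measureReal_pi_abs_sum_ge_le (fun i => η i u) hφ hφ1 ha
    _ = _ := by simp

/-! ### Concentration of the particle averages, propagated in time -/

/-- One term of the exponential series, `x ^ m / m! ≤ exp x` at `x = s ^ 2 / 2`, turns the Gaussian
tail into a power tail. Power tails keep their form when `s` is rescaled, which the induction over
time needs. -/
theorem two_mul_exp_neg_sq_div_two_le {s : ℝ} (hs : 0 < s) (m : ℕ) :
    2 * Real.exp (-s ^ 2 / 2) ≤ 2 * (m.factorial * 2 ^ m) / s ^ (2 * m) := by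
  have h := Real.pow_div_factorial_le_exp (x := s ^ 2 / 2) (by positivity) m
  rw [neg_div, Real.exp_neg, mul_div_assoc]
  gcongr
  rw [inv_le_comm₀ (Real.exp_pos _) (by positivity)]
  refine le_trans (le_of_eq ?_) h
  rw [inv_div, div_pow, ← pow_mul]
  field_simp

/-- The averages over the `N` particles `Z N` approximate integrals against `μ` at rate `N^(-1/2)`,
uniformly over measurable functions bounded by `1`, with tails that decay faster than any power. -/
def HasEmpiricalTails {S Ω : Type*} [MeasurableSpace S] [MeasurableSpace Ω] (P : Measure Ω)
    (Z : (N : ℕ) → Fin N → Ω → S) (μ : Measure S) : Prop :=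
  ∀ m : ℕ, ∃ C : ℝ, 0 ≤ C ∧ ∀ N : ℕ, 1 ≤ N → ∀ φ : S → ℝ, Measurable φ → (∀ x, |φ x| ≤ 1) →
    ∀ s : ℝ, 0 < s →
      P.real {ω | s / √(N : ℝ) ≤ |1 / (N : ℝ) * ∑ i, φ (Z N i ω) - ∫ x, φ x ∂μ|} ≤
        C / s ^ (2 * m)

theorem le_abs_sum_sub_of_le_abs_average_sub {N : ℕ} (hN : 1 ≤ N) {a b : Fin N → ℝ} {s : ℝ}
    (h : s / √(N : ℝ) ≤ |1 / (N : ℝ) * ∑ i, a i - 1 / (N : ℝ) * ∑ i, b i|) :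
    s * √(N : ℝ) ≤ |∑ i, (a i - b i)| := by
  have hN' : (0 : ℝ) < N := by exact_mod_cast hN
  rw [← mul_sub, ← Finset.sum_sub_distrib, abs_mul, abs_of_pos (by positivity)] at h
  have h2 := mul_le_mul_of_nonneg_left h hN'.le
  rw [← mul_assoc, mul_one_div_cancel hN'.ne', one_mul] at h2
  refine le_trans (le_of_eq ?_) h2
  have hs : √(N : ℝ) ≠ 0 := by positivity
  field_simp
  rw [Real.sq_sqrt hN'.le]

theorem exp_neg_sq_mul_sqrt {N : ℕ} (hN : 1 ≤ N) (s : ℝ) :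
    Real.exp (-(s * √(N : ℝ)) ^ 2 / (2 * N)) = Real.exp (-s ^ 2 / 2) := by
  have hN' : (0 : ℝ) < N := by exact_mod_cast hN
  rw [mul_pow, Real.sq_sqrt hN'.le]
  congr 1
  field_simp

theorem measureReal_average_sub_ge_le_of_condIndep {Ω E S : Type*} {m : MeasurableSpace Ω}
    [mΩ : MeasurableSpace Ω] [MeasurableSpace E] [MeasurableSpace S] {N : ℕ} (hN : 1 ≤ N)
    (P : Measure Ω) [IsProbabilityMeasure P] (hm : m ≤ mΩ) {U : Ω → E} (hU : Measurable[m] U)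
    {V : Fin N → Ω → S} (hV : ∀ i, Measurable (V i)) (η : Fin N → Kernel E S)
    [∀ i, IsMarkovKernel (η i)]
    (h : ∀ B : Fin N → Set S, (∀ i, MeasurableSet (B i)) →
      P[(⋂ i, V i ⁻¹' B i).indicator (fun _ => (1 : ℝ)) | m]
        =ᵐ[P] fun ω => ∏ i, (η i (U ω)).real (B i))
    {φ : S → ℝ} (hφ : Measurable φ) (hφ1 : ∀ x, |φ x| ≤ 1) {s : ℝ} (hs : 0 < s) (n : ℕ) :
    P.real {ω | s / √(N : ℝ) ≤
      |1 / (N : ℝ) * ∑ i, φ (V i ω) - 1 / (N : ℝ) * ∑ i, ∫ x, φ x ∂η i (U ω)|} ≤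
      2 * (n.factorial * 2 ^ n) / s ^ (2 * n) := by
  refine le_trans (measureReal_mono fun ω hω => ?_)
    ((measureReal_abs_sum_ge_le_of_condIndep P hm hU hV η h hφ hφ1
      (a := s * √(N : ℝ)) (by positivity)).trans ?_)
  · exact le_abs_sum_sub_of_le_abs_average_sub hN hω
  · rw [exp_neg_sq_mul_sqrt hN]
    exact two_mul_exp_neg_sq_div_two_le hs n

theorem hasEmpiricalTails_of_map_eq_pi {S Ω : Type*} [MeasurableSpace S] [MeasurableSpace Ω]
    {P : Measure Ω} {Z : (N : ℕ) → Fin N → Ω → S} {μ : Measure S}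
    [IsProbabilityMeasure μ] (hZ : ∀ N, 1 ≤ N → ∀ i, Measurable (Z N i))
    (h : ∀ N, 1 ≤ N → P.map (fun ω i => Z N i ω) = Measure.pi fun _ => μ) :
    HasEmpiricalTails P Z μ := by
  refine fun m => ⟨2 * (m.factorial * 2 ^ m), by positivity, fun N hN φ hφ hφ1 s hs => ?_⟩
  have hN' : (0 : ℝ) < N := by exact_mod_cast hN
  have hpre : {ω | s / √(N : ℝ) ≤ |1 / (N : ℝ) * ∑ i, φ (Z N i ω) - ∫ x, φ x ∂μ|} =
      (fun ω i => Z N i ω) ⁻¹'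
        {y : Fin N → S | s / √(N : ℝ) ≤ |1 / (N : ℝ) * ∑ i, φ (y i) - ∫ x, φ x ∂μ|} := rfl
  have hmeas : MeasurableSet
      {y : Fin N → S | s / √(N : ℝ) ≤ |1 / (N : ℝ) * ∑ i, φ (y i) - ∫ x, φ x ∂μ|} := by
    refine measurableSet_le measurable_const (Measurable.abs (Measurable.sub_const ?_ _))
    exact (Finset.measurable_sum _ fun i _ => hφ.comp (measurable_pi_apply i)).const_mul _
  rw [hpre, ← map_measureReal_apply (measurable_pi_lambda _ (hZ N hN)) hmeas, h N hN]
  refine le_trans (measureReal_mono fun y hy => ?_)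
    ((measureReal_pi_abs_sum_ge_le (fun _ : Fin N => μ) hφ hφ1
      (a := s * √(N : ℝ)) (by positivity)).trans ?_)
  · refine le_abs_sum_sub_of_le_abs_average_sub hN (le_trans (show s / √(N : ℝ) ≤ _ from hy) ?_)
    refine le_of_eq ?_
    simp only [Finset.sum_const, Finset.card_univ, Fintype.card_fin, nsmul_eq_mul]
    rw [← mul_assoc, one_div_mul_cancel hN'.ne', one_mul]
  · rw [exp_neg_sq_mul_sqrt hN]
    exact two_mul_exp_neg_sq_div_two_le hs m

theorem particleHistory_le {S Ω : Type*} [MeasurableSpace S] [mΩ : MeasurableSpace Ω] {N : ℕ}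
    {X Y : ℕ → Fin N → Ω → S} (hX : ∀ t i, Measurable (X t i)) (hY : ∀ t i, Measurable (Y t i))
    (t : ℕ) : particleHistory X Y t ≤ mΩ :=
  sup_le (iSup₂_le fun s _ => iSup_le fun i => (hX s i).comap_le)
    (iSup₂_le fun s _ => iSup_le fun i => (hY s i).comap_le)

theorem measurable_particleHistory {S Ω : Type*} [MeasurableSpace S] {N : ℕ}
    (X Y : ℕ → Fin N → Ω → S) (t : ℕ) :
    Measurable[particleHistory X Y t] fun ω i => X t i ω := by
  refine @measurable_pi_lambda _ _ _ (particleHistory X Y t) _ _ fun i => ?_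
  refine (comap_measurable (X t i)).mono ?_ le_rfl
  exact le_sup_of_le_left (le_iSup₂_of_le t (Set.mem_Iic.2 le_rfl) (le_iSup_of_le i le_rfl))

/-- The error splits into three parts: the fluctuation of the jittered particles given the past, the
bias of the kernel, and the error before jittering. The bias is deterministic, at most `|c| / √N`,
so each part may be compared with a third of `s / √N`. -/
theorem HasEmpiricalTails.jitter {S Ω : Type*} [MeasurableSpace S] [MeasurableSpace Ω]
    {P : Measure Ω} [IsProbabilityMeasure P] {π₀ : Measure S} {κ : ℕ → Kernel S S}
    [∀ N, IsMarkovKernel (κ N)] (hκ : JitterBound κ) {G : ℕ → S → ℝ} {T t : ℕ} (ht : t < T)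
    {X Y : (N : ℕ) → ℕ → Fin N → Ω → S}
    (hX : ∀ N, 1 ≤ N → IsParticleSystem P π₀ (κ N) G T N (X N) (Y N)) {μ : Measure S}
    (h : HasEmpiricalTails P (fun N => X N t) μ) :
    HasEmpiricalTails P (fun N => Y N (t + 1)) μ := by
  obtain ⟨c, hc⟩ := hκ
  intro m
  obtain ⟨C, hC0, hC⟩ := h m
  set C₁ : ℝ := 2 * (m.factorial * 2 ^ m)
  -- The powers of `3` come from using `s / 3` in two tail bounds. The last summand makes the claim
  -- trivial for `s ≤ 3 * (|c| + 1)`; for larger `s` the bias is below `s / 3 / √N`.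
  refine ⟨3 ^ (2 * m) * C₁ + 3 ^ (2 * m) * C + (3 * (|c| + 1)) ^ (2 * m), by positivity,
    fun N hN φ hφ hφ1 s hs => ?_⟩
  have hN' : (0 : ℝ) < N := by exact_mod_cast hN
  have hsN : 0 < √(N : ℝ) := by positivity
  rcases le_or_gt s (3 * (|c| + 1)) with hsc | hsc
  · refine measureReal_le_one.trans ?_
    rw [one_le_div (by positivity)]
    have := pow_le_pow_left₀ hs.le hsc (2 * m)
    have h1 : 0 ≤ 3 ^ (2 * m) * C₁ := by positivity
    have h2 : 0 ≤ 3 ^ (2 * m) * C := by positivity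
    linarith
  have hbias : ∀ x, |(∫ y, φ y ∂κ N x) - φ x| ≤ |c| / √(N : ℝ) := by
    intro x
    have h_int : Integrable φ (κ N x) :=
      Integrable.of_bound hφ.aestronglyMeasurable 1 (ae_of_all _ hφ1)
    have hbd : BddAbove (Set.range fun x => |φ x|) := ⟨1, by rintro _ ⟨x, rfl⟩; exact hφ1 x⟩
    have : Nonempty S := ⟨x⟩
    calc |(∫ y, φ y ∂κ N x) - φ x| = |∫ y, (φ y - φ x) ∂κ N x| := by
          rw [integral_sub h_int (integrable_const _)]; simp
      _ ≤ ∫ y, |φ y - φ x| ∂κ N x := abs_integral_le_integral_abs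
      _ ≤ c * (⨆ x, |φ x|) / √(N : ℝ) := hc N hN φ hφ hbd x
      _ ≤ |c| / √(N : ℝ) := by
          gcongr
          calc c * (⨆ x, |φ x|) ≤ |c| * (⨆ x, |φ x|) := by
                gcongr
                · exact Real.iSup_nonneg fun _ => abs_nonneg _
                · exact le_abs_self c
            _ ≤ |c| * 1 := by gcongr; exact ciSup_le hφ1
            _ = |c| := mul_one _
  have hH := measureReal_average_sub_ge_le_of_condIndep hN P
    (particleHistory_le (hX N hN).measurable_X (hX N hN).measurable_Y t)
    (measurable_particleHistory (X N) (Y N) t) ((hX N hN).measurable_Y (t + 1))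
    (fun i => (κ N).comap (fun x : Fin N → S => x i) (measurable_pi_apply i))
    (by simpa [Kernel.comap_apply] using (hX N hN).jitter t ht) hφ hφ1
    (s := s / 3) (by positivity) m
  have hP := hC N hN φ hφ hφ1 (s / 3) (by positivity)
  simp only [Kernel.comap_apply] at hH
  refine (measureReal_mono (s₂ := _ ∪ _) fun ω hω => ?_).trans
    ((measureReal_union_le _ _).trans (add_le_add hH hP |>.trans ?_))
  · by_contra hcon
    simp only [Set.mem_union, Set.mem_ofPred_eq, not_or, not_le] at hcon hω
    obtain ⟨h1, h2⟩ := hcon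
    have h3 : |1 / (N : ℝ) * ∑ i, ∫ x, φ x ∂κ N (X N t i ω) -
        1 / (N : ℝ) * ∑ i, φ (X N t i ω)| ≤ |c| / √(N : ℝ) := by
      rw [← mul_sub, ← Finset.sum_sub_distrib, abs_mul, abs_of_pos (by positivity)]
      calc _ ≤ 1 / (N : ℝ) * ∑ i : Fin N, |c| / √(N : ℝ) := by
            gcongr
            exact (Finset.abs_sum_le_sum_abs _ _).trans
              (Finset.sum_le_sum fun i _ => hbias _)
        _ = _ := by
            simp only [Finset.sum_const, Finset.card_univ, Fintype.card_fin, nsmul_eq_mul]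
            field_simp
    have h4 : |c| / √(N : ℝ) < s / 3 / √(N : ℝ) := by
      gcongr
      linarith
    have h5 : s / √(N : ℝ) = s / 3 / √(N : ℝ) + s / 3 / √(N : ℝ) + s / 3 / √(N : ℝ) := by ring
    have h6 := abs_le.1 h3
    have h7 := abs_lt.1 h1
    have h8 := abs_lt.1 h2
    rcases le_abs.1 hω with h9 | h9 <;> linarith [h6.1, h6.2, h7.1, h7.2, h8.1, h8.2]
  · rw [div_pow, ← add_div, div_div_eq_mul_div]
    gcongr
    have h1 : 0 ≤ (3 * (|c| + 1)) ^ (2 * m) := by positivity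
    linarith

theorem measurable_weight {S : Type*} [MeasurableSpace S] {N : ℕ} {g : S → ℝ} (hg : Measurable g)
    (j : Fin N) : Measurable fun y : Fin N → S => weight g y j :=
  (hg.comp (measurable_pi_apply j)).div
    (Finset.measurable_sum _ fun i _ => hg.comp (measurable_pi_apply i))

theorem weight_nonneg {S : Type*} {N : ℕ} {g : S → ℝ} (hg : ∀ x, 0 < g x) (y : Fin N → S)
    (j : Fin N) : 0 ≤ weight g y j :=
  div_nonneg (hg _).le (Finset.sum_nonneg fun _ _ => (hg _).le)

theorem sum_pos_of_pos {S : Type*} {N : ℕ} (hN : 1 ≤ N) {g : S → ℝ} (hg : ∀ x, 0 < g x)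
    (y : Fin N → S) : 0 < ∑ j, g (y j) := by
  have : Nonempty (Fin N) := ⟨⟨0, hN⟩⟩
  exact Finset.sum_pos (fun _ _ => hg _) Finset.univ_nonempty

theorem sum_weight {S : Type*} {N : ℕ} (hN : 1 ≤ N) {g : S → ℝ} (hg : ∀ x, 0 < g x)
    (y : Fin N → S) : ∑ j, weight g y j = 1 := by
  simp only [weight, ← Finset.sum_div]
  exact div_self (ne_of_gt (sum_pos_of_pos hN hg y))

/-- The weighted empirical measure, as a kernel. -/
noncomputable def weightedKernel {S : Type*} [MeasurableSpace S] (N : ℕ) {g : S → ℝ}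
    (hg : Measurable g) : Kernel (Fin N → S) S where
  toFun y := ∑ j, ENNReal.ofReal (weight g y j) • Measure.dirac (y j)
  measurable' := by
    refine Measure.measurable_of_measurable_coe _ fun B hB => ?_
    simp only [Measure.coe_finsetSum, Finset.sum_apply, Measure.smul_apply, smul_eq_mul]
    refine Finset.measurable_sum _ fun j _ => (measurable_weight hg j).ennreal_ofReal.mul ?_
    exact ((Measure.measurable_coe hB).comp Measure.measurable_dirac).comp (measurable_pi_apply j)

theorem weightedKernel_apply {S : Type*} [MeasurableSpace S] {N : ℕ} {g : S → ℝ}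
    (hg : Measurable g) (y : Fin N → S) :
    weightedKernel N hg y = ∑ j, ENNReal.ofReal (weight g y j) • Measure.dirac (y j) := rfl

theorem isMarkovKernel_weightedKernel {S : Type*} [MeasurableSpace S] {N : ℕ} (hN : 1 ≤ N)
    {g : S → ℝ} (hg : Measurable g) (hpos : ∀ x, 0 < g x) :
    IsMarkovKernel (weightedKernel N hg) := by
  refine ⟨fun y => ⟨?_⟩⟩
  rw [weightedKernel_apply]
  simp only [Measure.coe_finsetSum, Finset.sum_apply, Measure.smul_apply, smul_eq_mul,
    measure_univ, mul_one]
  rw [← ENNReal.ofReal_sum_of_nonneg fun j _ => weight_nonneg hpos y j, sum_weight hN hpos]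
  simp

theorem integral_weightedKernel {S : Type*} [MeasurableSpace S] {N : ℕ}
    {g : S → ℝ} (hg : Measurable g) (hpos : ∀ x, 0 < g x) {φ : S → ℝ} (hφ : Measurable φ)
    (y : Fin N → S) : ∫ x, φ x ∂weightedKernel N hg y = ∑ j, weight g y j * φ (y j) := by
  rw [weightedKernel_apply, integral_finsetSum_measure]
  · refine Finset.sum_congr rfl fun j _ => ?_
    rw [integral_smul_measure, integral_dirac' _ _ hφ.stronglyMeasurable,
      ENNReal.toReal_ofReal (weight_nonneg hpos y j), smul_eq_mul]
  · intro j _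
    refine Integrable.smul_measure ?_ ENNReal.ofReal_ne_top
    exact integrable_dirac' hφ.stronglyMeasurable (by simp)

theorem weightedKernel_real_apply {S : Type*} [MeasurableSpace S] {N : ℕ}
    {g : S → ℝ} (hg : Measurable g) (hpos : ∀ x, 0 < g x) {B : Set S} (hB : MeasurableSet B)
    (y : Fin N → S) : (weightedKernel N hg y).real B =
      ∑ j, weight g y j * B.indicator (fun _ => (1 : ℝ)) (y j) := by
  rw [← integral_weightedKernel hg hpos (measurable_const.indicator hB),
    integral_indicator_const _ hB]
  simp

/-- Given the jittered particles, the mean of `φ` after resampling is the ratio of the averages of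
`g * φ` and `g`, while the target is the ratio of the corresponding integrals. Two applications of
the hypothesis control numerator and denominator, and conditional Hoeffding controls the sampling
noise. -/
theorem HasEmpiricalTails.resample {S Ω : Type*} [MeasurableSpace S] [MeasurableSpace Ω]
    {P : Measure Ω} [IsProbabilityMeasure P] {π₀ : Measure S} {κ : ℕ → Kernel S S}
    {G : ℕ → S → ℝ} {T t : ℕ} (ht : t < T) (hG : PositiveBoundedPotentials G T)
    {X Y : (N : ℕ) → ℕ → Fin N → Ω → S}
    (hX : ∀ N, 1 ≤ N → IsParticleSystem P π₀ (κ N) G T N (X N) (Y N)) {μ ν : Measure S}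
    [IsProbabilityMeasure μ]
    (hν : ∀ φ : S → ℝ, ∫ x, φ x ∂ν = (∫ x, G (t + 1) x * φ x ∂μ) / ∫ x, G (t + 1) x ∂μ)
    (h : HasEmpiricalTails P (fun N => Y N (t + 1)) μ) :
    HasEmpiricalTails P (fun N => X N (t + 1)) ν := by
  obtain ⟨hg, hpos, M, hM⟩ := hG (t + 1) (by omega) (by omega)
  set g := G (t + 1) with hgdef
  have hgM : ∀ x, g x ≤ M := fun x => hM ⟨x, rfl⟩
  have : Nonempty S := nonempty_of_isProbabilityMeasure μ
  have hM0 : 0 < M := (hpos (Classical.arbitrary S)).trans_le (hgM _)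
  have hgint : Integrable g μ := Integrable.of_bound hg.aestronglyMeasurable M
    (ae_of_all _ fun x => by rw [Real.norm_of_nonneg (hpos x).le]; exact hgM x)
  set b : ℝ := ∫ x, g x ∂μ with hb
  have hb0 : 0 < b := by
    rw [hb, integral_pos_iff_support_of_nonneg (fun x => (hpos x).le) hgint]
    have : Function.support g = Set.univ := by ext x; simp [(hpos x).ne']
    simp [this]
  intro m
  obtain ⟨C, hC0, hC⟩ := h m
  set C₁ : ℝ := 2 * (m.factorial * 2 ^ m)
  -- Chosen so that the two errors `M * (r * s / √N)` add up to `b` times `s / 2 / √N`. The factor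
  -- `M` appears because the test functions are divided by `M` to be bounded by `1`.
  set r : ℝ := b / (4 * M) with hr
  have hr0 : 0 < r := by positivity
  refine ⟨2 ^ (2 * m) * C₁ + (C / r ^ (2 * m) + C / r ^ (2 * m)), by positivity,
    fun N hN φ hφ hφ1 s hs => ?_⟩
  have hN' : (0 : ℝ) < N := by exact_mod_cast hN
  have hsN : 0 < √(N : ℝ) := by positivity
  have := isMarkovKernel_weightedKernel hN hg hpos
  have hH := measureReal_average_sub_ge_le_of_condIndep hN P
    (m := particleHistory (X N) (Y N) t ⊔
      ⨆ i, MeasurableSpace.comap (Y N (t + 1) i) inferInstance)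
    (sup_le (particleHistory_le (hX N hN).measurable_X (hX N hN).measurable_Y t)
      (iSup_le fun i => ((hX N hN).measurable_Y (t + 1) i).comap_le))
    (U := fun ω i => Y N (t + 1) i ω)
    (by
      refine @measurable_pi_lambda _ _ _ (_) _ _ fun i => ?_
      refine (comap_measurable (Y N (t + 1) i)).mono ?_ le_rfl
      exact le_sup_of_le_right (le_iSup_of_le i le_rfl))
    ((hX N hN).measurable_X (t + 1)) (fun _ => weightedKernel N hg)
    (by
      intro B hB
      simp only [weightedKernel_real_apply hg hpos (hB _)]
      exact (hX N hN).resample t ht B hB) hφ hφ1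
    (s := s / 2) (by positivity) m
  have hP1 := hC N hN (fun x => g x / M * φ x) ((hg.div_const _).mul hφ)
    (fun x => by
      rw [abs_mul, abs_of_pos (div_pos (hpos x) hM0)]
      exact mul_le_one₀ ((div_le_one hM0).2 (hgM x)) (abs_nonneg _) (hφ1 x))
    (r * s) (by positivity)
  have hP2 := hC N hN (fun x => g x / M) (hg.div_const _)
    (fun x => by
      rw [abs_of_pos (div_pos (hpos x) hM0)]
      exact (div_le_one hM0).2 (hgM x))
    (r * s) (by positivity)
  refine (measureReal_mono (s₂ := _ ∪ (_ ∪ _)) fun ω hω => ?_).trans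
    ((measureReal_union_le _ _).trans (add_le_add hH
      ((measureReal_union_le _ _).trans (add_le_add hP1 hP2)) |>.trans ?_))
  · by_contra hcon
    simp only [Set.mem_union, Set.mem_ofPred_eq, not_or, not_le] at hcon hω
    obtain ⟨h1, h2, h3⟩ := hcon
    simp only [integral_weightedKernel hg hpos hφ, Finset.sum_const, Finset.card_univ,
      Fintype.card_fin, nsmul_eq_mul] at h1
    rw [hν] at hω
    set y : Fin N → S := fun i => Y N (t + 1) i ω with hy
    have hS := sum_pos_of_pos hN hpos y
    set w := ∑ j, weight g y j * φ (y j) with hw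
    have hw1 : |w| ≤ 1 := by
      refine (Finset.abs_sum_le_sum_abs _ _).trans ?_
      rw [← sum_weight hN hpos y]
      refine Finset.sum_le_sum fun j _ => ?_
      rw [abs_mul, abs_of_nonneg (weight_nonneg hpos y j)]
      exact mul_le_of_le_one_right (weight_nonneg hpos y j) (hφ1 _)
    have hwS : ∑ j, g (y j) * φ (y j) = w * ∑ j, g (y j) := by
      rw [hw, Finset.sum_mul]
      refine Finset.sum_congr rfl fun j _ => ?_
      rw [weight]
      field_simp
    have e1 : ∑ j, g (y j) / M * φ (y j) = (w * ∑ j, g (y j)) / M := by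
      rw [← hwS, Finset.sum_div]
      exact Finset.sum_congr rfl fun j _ => by ring
    have e2 : ∫ x, g x / M * φ x ∂μ = (∫ x, g x * φ x ∂μ) / M := by
      rw [← integral_div]
      exact integral_congr_ae (ae_of_all _ fun x => by ring)
    have e3 : ∫ x, g x / M ∂μ = b / M := integral_div _ _
    change |1 / (N : ℝ) * ∑ j, g (y j) / M * φ (y j) - _| < _ at h2
    change |1 / (N : ℝ) * ∑ j, g (y j) / M - _| < _ at h3
    rw [e1, e2] at h2
    rw [e3, ← Finset.sum_div] at h3
    rw [← mul_assoc, one_div_mul_cancel hN'.ne', one_mul] at h1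
    set a := ∫ x, g x * φ x ∂μ
    set A := 1 / (N : ℝ) * ∑ j, g (y j) with hA
    have h2' : |w * A - a| < M * (r * s / √(N : ℝ)) := by
      rw [← div_lt_iff₀' hM0]
      refine lt_of_eq_of_lt ?_ h2
      rw [show 1 / (N : ℝ) * (w * (∑ j, g (y j)) / M) - a / M = (w * A - a) / M by rw [hA]; ring,
        abs_div, abs_of_pos hM0]
    have h3' : |A - b| < M * (r * s / √(N : ℝ)) := by
      rw [← div_lt_iff₀' hM0]
      refine lt_of_eq_of_lt ?_ h3
      rw [show 1 / (N : ℝ) * ((∑ j, g (y j)) / M) - b / M = (A - b) / M by rw [hA]; ring,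
        abs_div, abs_of_pos hM0]
    -- Because `|w| ≤ 1`, the decomposition below has only the constant `b` in its denominator; no
    -- lower bound on the random normalization `A` is required.
    have h4 : |w - a / b| < s / 2 / √(N : ℝ) := by
      rw [show w - a / b = ((w * A - a) + w * (b - A)) / b by field_simp; ring, abs_div,
        abs_of_pos hb0, div_lt_iff₀ hb0]
      have h5 : |w * (b - A)| ≤ |A - b| := by
        rw [abs_mul, abs_sub_comm b A]
        exact mul_le_of_le_one_left (abs_nonneg _) hw1
      have h6 : M * (r * s / √(N : ℝ)) + M * (r * s / √(N : ℝ)) = s / 2 / √(N : ℝ) * b := by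
        rw [hr]; field_simp; ring
      linarith [abs_add_le (w * A - a) (w * (b - A))]
    have h7 := abs_lt.1 h1
    have h8 := abs_lt.1 h4
    have h5 : s / √(N : ℝ) = s / 2 / √(N : ℝ) + s / 2 / √(N : ℝ) := by ring
    rcases le_abs.1 hω with h9 | h9 <;> linarith [h7.1, h7.2, h8.1, h8.2]
  · refine le_of_eq ?_
    rw [div_pow, mul_pow]
    simp only [C₁]
    field_simp

theorem integral_potentialFlow_succ {S : Type*} [MeasurableSpace S] {π₀ : Measure S}
    {G : ℕ → S → ℝ} {T t : ℕ} (ht : t < T) (hG : PositiveBoundedPotentials G T)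
    [IsProbabilityMeasure (potentialFlow π₀ G t)] (φ : S → ℝ) :
    ∫ x, φ x ∂potentialFlow π₀ G (t + 1) =
      (∫ x, G (t + 1) x * φ x ∂potentialFlow π₀ G t) / ∫ x, G (t + 1) x ∂potentialFlow π₀ G t := by
  obtain ⟨hg, hpos, M, hM⟩ := hG (t + 1) (by omega) (by omega)
  have hgint : Integrable (G (t + 1)) (potentialFlow π₀ G t) :=
    Integrable.of_bound hg.aestronglyMeasurable M
      (ae_of_all _ fun x => by rw [Real.norm_of_nonneg (hpos x).le]; exact hM ⟨x, rfl⟩)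
  rw [potentialFlow, integral_smul_measure,
    integral_withDensity_eq_integral_toReal_smul hg.ennreal_ofReal
      (ae_of_all _ fun _ => ENNReal.ofReal_lt_top),
    ← ofReal_integral_eq_lintegral_ofReal hgint (ae_of_all _ fun x => (hpos x).le),
    ENNReal.toReal_inv, ENNReal.toReal_ofReal (integral_nonneg fun x => (hpos x).le)]
  simp only [ENNReal.toReal_ofReal (hpos _).le, smul_eq_mul]
  rw [div_eq_inv_mul]

theorem isProbabilityMeasure_potentialFlow {S : Type*} [MeasurableSpace S] {π₀ : Measure S}
    [IsProbabilityMeasure π₀] {G : ℕ → S → ℝ} {T : ℕ} (hG : PositiveBoundedPotentials G T) :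
    ∀ t ≤ T, IsProbabilityMeasure (potentialFlow π₀ G t)
  | 0, _ => inferInstanceAs (IsProbabilityMeasure π₀)
  | t + 1, ht => by
    have := isProbabilityMeasure_potentialFlow (π₀ := π₀) hG t (by omega)
    obtain ⟨hg, hpos, M, hM⟩ := hG (t + 1) (by omega) ht
    refine ⟨?_⟩
    rw [potentialFlow, Measure.smul_apply, withDensity_apply _ MeasurableSet.univ,
      Measure.restrict_univ, smul_eq_mul]
    refine ENNReal.inv_mul_cancel ?_ ?_
    · rw [Ne, lintegral_eq_zero_iff hg.ennreal_ofReal]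
      intro h0
      obtain ⟨x, hx⟩ := h0.exists
      simp [(hpos x).not_ge] at hx
    · refine ne_of_lt ((lintegral_mono fun x => ENNReal.ofReal_le_ofReal (hM ⟨x, rfl⟩)).trans_lt ?_)
      simp

/-- The particle approximation of the flow `π_t` converges at the Monte Carlo rate. -/
theorem hasEmpiricalTails_potentialFlow {S Ω : Type*} [MeasurableSpace S] [MeasurableSpace Ω]
    {P : Measure Ω} [IsProbabilityMeasure P] {π₀ : Measure S} [IsProbabilityMeasure π₀]
    {κ : ℕ → Kernel S S} [∀ N, IsMarkovKernel (κ N)] (hκ : JitterBound κ)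
    {G : ℕ → S → ℝ} {T : ℕ} (hG : PositiveBoundedPotentials G T)
    {X Y : (N : ℕ) → ℕ → Fin N → Ω → S}
    (hX : ∀ N, 1 ≤ N → IsParticleSystem P π₀ (κ N) G T N (X N) (Y N)) :
    ∀ t ≤ T, HasEmpiricalTails P (fun N => X N t) (potentialFlow π₀ G t)
  | 0, _ => hasEmpiricalTails_of_map_eq_pi (μ := π₀) (fun N hN => (hX N hN).measurable_X 0)
      fun N hN => (hX N hN).init
  | t + 1, ht => by
    have := isProbabilityMeasure_potentialFlow (π₀ := π₀) hG t (by omega)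
    exact ((hasEmpiricalTails_potentialFlow hκ hG hX t (by omega)).jitter hκ ht hX).resample
      ht hG hX (integral_potentialFlow_succ ht hG)

/-! ### Regularity of the kernel and bias of smoothing -/

theorem IsMixedPartials.hasDerivAt_add_smul {d : ℕ} {f : EuclideanSpace ℝ (Fin d) → ℝ}
    {D : Finset (Fin d) → EuclideanSpace ℝ (Fin d) → ℝ} (hD : IsMixedPartials Set.univ f D)
    (i : Fin d) (x : EuclideanSpace ℝ (Fin d)) (t : ℝ) :
    HasDerivAt (fun t : ℝ => f (x + t • EuclideanSpace.single i (1 : ℝ)))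
      (D {i} (x + t • EuclideanSpace.single i (1 : ℝ))) t := by
  have h := hD.step ∅ i (by simp) (x + t • EuclideanSpace.single i (1 : ℝ)) (Set.mem_univ _)
  have hf : D ∅ = f := funext fun x => hD.zero x (Set.mem_univ x)
  rw [hf, HasLineDerivWithinAt, Set.preimage_univ, hasDerivWithinAt_univ] at h
  have h' := HasDerivAt.comp_sub_const (x := t) t (f := fun s : ℝ =>
    f (x + t • EuclideanSpace.single i (1 : ℝ) + s • EuclideanSpace.single i (1 : ℝ)))
    (by simpa using h)
  refine h'.congr_of_eventuallyEq (Eventually.of_forall fun s => ?_) |>.congr_deriv (by simp)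
  simp only [add_assoc, ← add_smul]
  congr 3
  ring

/-- Moving from `y` to `x` one coordinate at a time, the mean value inequality bounds each move by
the supremum of a first partial derivative. -/
theorem IsRegularKernel.exists_bound_lipschitz {d : ℕ} {k : EuclideanSpace ℝ (Fin d) → ℝ}
    (hk : IsRegularKernel k) :
    ∃ B : ℝ, 0 < B ∧ (∀ x, |k x| ≤ B) ∧ ∀ x y, |k x - k y| ≤ B * ‖x - y‖ := by
  obtain ⟨D, hD, hb⟩ := hk.mixed_partials
  choose _ C hC using hb
  have hC0 : ∀ A, 0 ≤ C A := fun A => (abs_nonneg _).trans (hC A 0)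
  have hcoord : ∀ (i : Fin d) (x : EuclideanSpace ℝ (Fin d)) (t : ℝ),
      |k (x + t • EuclideanSpace.single i (1 : ℝ)) - k x| ≤ C {i} * |t| := by
    intro i x t
    have h := Convex.norm_image_sub_le_of_norm_hasDerivWithin_le (s := Set.univ) (x := 0) (y := t)
      (fun s _ => (hD.hasDerivAt_add_smul i x s).hasDerivWithinAt)
      (fun s _ => hC {i} _) convex_univ (Set.mem_univ _) (Set.mem_univ _)
    simpa using h
  have hpart : ∀ (x y : EuclideanSpace ℝ (Fin d)) (s : Finset (Fin d)),
      |k (x + ∑ i ∈ s, (y i - x i) • EuclideanSpace.single i (1 : ℝ)) - k x| ≤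
        ∑ i ∈ s, C {i} * |y i - x i| := by
    intro x y s
    induction s using Finset.induction_on with
    | empty => simp
    | insert i s his ih =>
      rw [Finset.sum_insert his, Finset.sum_insert his,
        show x + ((y i - x i) • EuclideanSpace.single i (1 : ℝ) +
            ∑ j ∈ s, (y j - x j) • EuclideanSpace.single j (1 : ℝ)) =
          x + ∑ j ∈ s, (y j - x j) • EuclideanSpace.single j (1 : ℝ) +
            (y i - x i) • EuclideanSpace.single i (1 : ℝ) by abel]
      exact (abs_sub_le _ _ _).trans (add_le_add (hcoord i _ _) ih)
  have hsum0 : 0 ≤ ∑ i, C {i} := Finset.sum_nonneg fun i _ => hC0 _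
  refine ⟨C ∅ + ∑ i, C {i} + 1, by linarith [hC0 ∅], fun x => ?_, fun x y => ?_⟩
  · rw [← hD.zero x (Set.mem_univ x)]
    linarith [hC ∅ x]
  · have h := hpart y x Finset.univ
    have e : y + ∑ i, (x i - y i) • EuclideanSpace.single i (1 : ℝ) = x := by
      ext j
      simp [Finset.sum_apply, Pi.single_apply]
    rw [e] at h
    refine h.trans ?_
    calc ∑ i, C {i} * |x i - y i| ≤ ∑ i, C {i} * ‖x - y‖ := by
          refine Finset.sum_le_sum fun i _ => mul_le_mul_of_nonneg_left ?_ (hC0 _)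
          simpa using PiLp.norm_apply_le (x - y) i
      _ = (∑ i, C {i}) * ‖x - y‖ := by rw [Finset.sum_mul]
      _ ≤ _ := by
          gcongr
          linarith [hC0 ∅]

theorem IsRegularKernel.integrable_norm_mul {d : ℕ} {k : EuclideanSpace ℝ (Fin d) → ℝ}
    (hk : IsRegularKernel k) : Integrable (fun x => ‖x‖ * k x) volume := by
  refine (hk.integrable.add hk.second_moment).mono'
    (continuous_norm.aestronglyMeasurable.mul hk.integrable.aestronglyMeasurable)
    (ae_of_all _ fun x => ?_)
  have h0 := hk.nonneg x
  rw [Real.norm_of_nonneg (mul_nonneg (norm_nonneg _) h0)]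
  simp only [Pi.add_apply]
  nlinarith [sq_nonneg (‖x‖ - 1), norm_nonneg x]

theorem scaledKernel_nonneg {d : ℕ} {k : EuclideanSpace ℝ (Fin d) → ℝ} (hk : IsRegularKernel k)
    {h : ℝ} (hh : 0 < h) (x : EuclideanSpace ℝ (Fin d)) : 0 ≤ scaledKernel k h x :=
  mul_nonneg (by positivity) (hk.nonneg _)

/-- The substitution `z = (θ - y) / h` integrates a cone with apex `θ` exactly. Cones of slope `L`
and `-L'` serve as majorant and minorant of the density, so the bias is the slope times `h` times
the first absolute moment. -/
theorem integrable_scaledKernel_sub_mul {d : ℕ} {k : EuclideanSpace ℝ (Fin d) → ℝ}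
    (hk : IsRegularKernel k) {h : ℝ} (hh : 0 < h) (θ : EuclideanSpace ℝ (Fin d)) (c L : ℝ) :
    Integrable (fun y => scaledKernel k h (θ - y) * (c + L * ‖y - θ‖)) volume ∧
    ∫ y, scaledKernel k h (θ - y) * (c + L * ‖y - θ‖) = c + L * h * ∫ x, ‖x‖ * k x := by
  set F : EuclideanSpace ℝ (Fin d) → ℝ := fun z => c * k z + L * h * (‖z‖ * k z) with hF
  have hFi : Integrable F := (hk.integrable.const_mul _).add (hk.integrable_norm_mul.const_mul _)
  have e : (fun y => scaledKernel k h (θ - y) * (c + L * ‖y - θ‖)) =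
      fun y => (h ^ d)⁻¹ * (fun z => F (h⁻¹ • z)) (θ - y) := by
    funext y
    simp only [hF, scaledKernel, norm_smul, norm_inv, Real.norm_of_nonneg hh.le,
      norm_sub_rev y θ]
    field_simp
  rw [e]
  constructor
  · exact ((hFi.comp_smul (inv_ne_zero hh.ne')).comp_sub_left θ).const_mul _
  · rw [integral_const_mul, integral_sub_left_eq_self (fun z => F (h⁻¹ • z)) volume θ,
      Measure.integral_comp_inv_smul_of_nonneg _ _ hh.le, finrank_euclideanSpace_fin, smul_eq_mul,
      ← mul_assoc, inv_mul_cancel₀ (by positivity), one_mul, hF,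
      integral_add (hk.integrable.const_mul _) (hk.integrable_norm_mul.const_mul _),
      integral_const_mul, integral_const_mul, hk.integral_eq_one, mul_one]

theorem HasLipschitzMixedPartials.exists_lipschitz {d : ℕ} {s : Set (EuclideanSpace ℝ (Fin d))}
    {f : EuclideanSpace ℝ (Fin d) → ℝ} (hf : HasLipschitzMixedPartials s f) :
    ∃ L : ℝ, 0 < L ∧ ∀ x ∈ s, ∀ y ∈ s, |f x - f y| ≤ L * ‖x - y‖ := by
  obtain ⟨D, hD, hL⟩ := hf
  obtain ⟨L, hL⟩ := hL ∅
  refine ⟨|L| + 1, by positivity, fun x hx y hy => ?_⟩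
  rw [← hD.zero x hx, ← hD.zero y hy]
  refine (hL x hx y hy).trans (mul_le_mul_of_nonneg_right ?_ (norm_nonneg _))
  linarith [le_abs_self L]

theorem continuousOn_of_abs_sub_le_mul_norm {E : Type*} [SeminormedAddCommGroup E] {s : Set E}
    {f : E → ℝ} {L : ℝ} (hf : ∀ x ∈ s, ∀ y ∈ s, |f x - f y| ≤ L * ‖x - y‖) :
    ContinuousOn f s := by
  refine LipschitzOnWith.continuousOn (K := L.toNNReal) (LipschitzOnWith.of_dist_le_mul ?_)
  intro x hx y hy
  rw [Real.dist_eq, dist_eq_norm]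
  exact (hf x hx y hy).trans
    (mul_le_mul_of_nonneg_right (Real.le_coe_toNNReal L) (norm_nonneg _))

theorem IsLebesgueDensity.integral_eq {d : ℕ} {Θ : Set (EuclideanSpace ℝ (Fin d))}
    (hΘ : MeasurableSet Θ) {μ : Measure Θ} {p : EuclideanSpace ℝ (Fin d) → ℝ}
    (hp : IsLebesgueDensity μ p) (hpc : ContinuousOn p Θ) (f : EuclideanSpace ℝ (Fin d) → ℝ) :
    ∫ x : Θ, f x ∂μ = ∫ x, f x * Θ.indicator p x := by
  have hm : Measurable fun x : Θ => ENNReal.ofReal (p x) :=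
    (continuousOn_iff_continuous_domRestrict.1 hpc).measurable.ennreal_ofReal
  rw [hp.2, integral_withDensity_eq_integral_toReal_smul hm
    (ae_of_all _ fun _ => ENNReal.ofReal_lt_top),
    integral_subtype_comap hΘ (fun x => (ENNReal.ofReal (p x)).toReal • f x),
    ← integral_indicator hΘ]
  refine integral_congr_ae (ae_of_all _ fun x => ?_)
  by_cases hx : x ∈ Θ
  · simp [hx, ENNReal.toReal_ofReal (hp.1 x hx), mul_comm]
  · simp [hx]

/-- Extending the density by zero can only lower it, so the upper cone persists outside `Θ` and the
bound holds up to the boundary. -/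
theorem integral_scaledKernel_le {d : ℕ} {Θ : Set (EuclideanSpace ℝ (Fin d))}
    (hΘ : MeasurableSet Θ) {μ : Measure Θ} {p : EuclideanSpace ℝ (Fin d) → ℝ}
    (hp : IsLebesgueDensity μ p) {L : ℝ} (hL : 0 ≤ L)
    (hpL : ∀ x ∈ Θ, ∀ y ∈ Θ, |p x - p y| ≤ L * ‖x - y‖)
    {k : EuclideanSpace ℝ (Fin d) → ℝ} (hk : IsRegularKernel k) {h : ℝ} (hh : 0 < h)
    {θ : EuclideanSpace ℝ (Fin d)} (hθ : θ ∈ Θ) :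
    ∫ x : Θ, scaledKernel k h (θ - x) ∂μ ≤ p θ + L * h * ∫ x, ‖x‖ * k x := by
  rw [hp.integral_eq hΘ (continuousOn_of_abs_sub_le_mul_norm hpL)
    (fun x => scaledKernel k h (θ - x)), ← (integrable_scaledKernel_sub_mul hk hh θ (p θ) L).2]
  refine integral_mono_of_nonneg (ae_of_all _ fun x => ?_)
    (integrable_scaledKernel_sub_mul hk hh θ (p θ) L).1 (ae_of_all _ fun x => ?_)
  · exact mul_nonneg (scaledKernel_nonneg hk hh _) (Set.indicator_nonneg hp.1 x)
  · refine mul_le_mul_of_nonneg_left ?_ (scaledKernel_nonneg hk hh _)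
    by_cases hx : x ∈ Θ
    · rw [Set.indicator_of_mem hx]
      linarith [le_abs_self (p x - p θ), hpL x hx θ hθ]
    · rw [Set.indicator_of_notMem hx]
      have := hp.1 θ hθ
      positivity

/-- Here the jump of the zero extension at the boundary matters, so a lower cone on the whole space
is assumed; `sub_mul_norm_le_indicator` supplies it near the mode. -/
theorem le_integral_scaledKernel {d : ℕ} {Θ : Set (EuclideanSpace ℝ (Fin d))}
    (hΘ : MeasurableSet Θ) {μ : Measure Θ} {p : EuclideanSpace ℝ (Fin d) → ℝ}
    (hp : IsLebesgueDensity μ p) {L : ℝ} (hL : 0 ≤ L)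
    (hpL : ∀ x ∈ Θ, ∀ y ∈ Θ, |p x - p y| ≤ L * ‖x - y‖)
    {k : EuclideanSpace ℝ (Fin d) → ℝ} (hk : IsRegularKernel k) {h : ℝ} (hh : 0 < h)
    {θ : EuclideanSpace ℝ (Fin d)} (hθ : θ ∈ Θ) {L' : ℝ}
    (hlow : ∀ x, p θ - L' * ‖x - θ‖ ≤ Θ.indicator p x) :
    p θ - L' * h * ∫ x, ‖x‖ * k x ≤ ∫ x : Θ, scaledKernel k h (θ - x) ∂μ := by
  have hpc := continuousOn_of_abs_sub_le_mul_norm hpL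
  have h1 := integrable_scaledKernel_sub_mul hk hh θ (p θ) L
  have h2 := integrable_scaledKernel_sub_mul hk hh θ (p θ) (-L')
  obtain ⟨B, -, -, hBL⟩ := hk.exists_bound_lipschitz
  have hkc : Continuous k := continuousOn_univ.1
    (continuousOn_of_abs_sub_le_mul_norm fun x _ y _ => hBL x y)
  rw [hp.integral_eq hΘ hpc (fun x => scaledKernel k h (θ - x)), sub_eq_add_neg,
    ← neg_mul, ← neg_mul, ← h2.2]
  refine integral_mono h2.1 (h1.1.mono' ?_ (ae_of_all _ fun x => ?_)) fun x => ?_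
  · refine Continuous.aestronglyMeasurable (by unfold scaledKernel; fun_prop) |>.mul ?_
    exact (aestronglyMeasurable_indicator_iff hΘ).2 (hpc.aestronglyMeasurable hΘ)
  · rw [Real.norm_of_nonneg
      (mul_nonneg (scaledKernel_nonneg hk hh _) (Set.indicator_nonneg hp.1 x))]
    refine mul_le_mul_of_nonneg_left ?_ (scaledKernel_nonneg hk hh _)
    by_cases hx : x ∈ Θ
    · rw [Set.indicator_of_mem hx]
      linarith [le_abs_self (p x - p θ), hpL x hx θ hθ]
    · rw [Set.indicator_of_notMem hx]
      have := hp.1 θ hθ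
      positivity
  · refine mul_le_mul_of_nonneg_left ?_ (scaledKernel_nonneg hk hh _)
    linarith [hlow x]

/-- Near an interior maximizer, the extension of a Lipschitz density by zero is still bounded below
by a cone. -/
theorem sub_mul_norm_le_indicator {E : Type*} [SeminormedAddCommGroup E] {Θ : Set E} {p : E → ℝ}
    {L r : ℝ} (hL : 0 ≤ L) (hr : 0 < r) (hp0 : ∀ x ∈ Θ, 0 ≤ p x)
    (hpL : ∀ x ∈ Θ, ∀ y ∈ Θ, |p x - p y| ≤ L * ‖x - y‖) {θstar : E}
    (hball : Metric.ball θstar r ⊆ Θ) (hmax : IsMaxOn p Θ θstar) {θ : E}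
    (hθ : ‖θ - θstar‖ < r / 2) (x : E) :
    p θ - (L + 2 * p θstar / r) * ‖x - θ‖ ≤ Θ.indicator p x := by
  have hθΘ : θ ∈ Θ := hball (by rw [mem_ball_iff_norm]; linarith)
  have hstar : 0 ≤ p θstar := hp0 _ (hball (Metric.mem_ball_self hr))
  by_cases hx : x ∈ Θ
  · rw [Set.indicator_of_mem hx]
    have h1 := hpL θ hθΘ x hx
    rw [norm_sub_rev] at h1
    have h2 : 0 ≤ 2 * p θstar / r * ‖x - θ‖ := by positivity
    linarith [le_abs_self (p θ - p x)]
  · rw [Set.indicator_of_notMem hx]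
    -- Points outside `Θ` are at distance at least `r / 2` from `θ`; over that distance the extra
    -- slope `2 * p θstar / r` brings the cone down to zero or below.
    have h1 : r / 2 ≤ ‖x - θ‖ := by
      by_contra! hcon
      refine hx (hball ?_)
      rw [mem_ball_iff_norm]
      calc ‖x - θstar‖ = ‖(x - θ) + (θ - θstar)‖ := by congr 1; abel
        _ ≤ ‖x - θ‖ + ‖θ - θstar‖ := norm_add_le _ _
        _ < r := by linarith
    have h2 : p θstar ≤ 2 * p θstar / r * ‖x - θ‖ := by
      calc p θstar = 2 * p θstar / r * (r / 2) := by field_simp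
        _ ≤ _ := by gcongr
    have h3 : p θ ≤ p θstar := hmax hθΘ
    have h4 : 0 ≤ L * ‖x - θ‖ := by positivity
    linarith

/-- The radius is so small that the density stays above half its value at the centre. -/
theorem le_integral_indicator_ball {d : ℕ} {Θ : Set (EuclideanSpace ℝ (Fin d))}
    (hΘ : MeasurableSet Θ) {μ : Measure Θ} {p : EuclideanSpace ℝ (Fin d) → ℝ}
    (hp : IsLebesgueDensity μ p) {L : ℝ} (hL : 0 ≤ L)
    (hpL : ∀ x ∈ Θ, ∀ y ∈ Θ, |p x - p y| ≤ L * ‖x - y‖)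
    {θstar : EuclideanSpace ℝ (Fin d)} {r : ℝ} (hr : 0 < r)
    (hball : Metric.ball θstar r ⊆ Θ) (hrL : L * r ≤ p θstar / 2) :
    p θstar / 2 * (r ^ d *
        (volume (Metric.ball (0 : EuclideanSpace ℝ (Fin d)) 1)).toReal) ≤
      ∫ x : Θ, (Metric.ball θstar r).indicator (fun _ => (1 : ℝ)) (x : EuclideanSpace ℝ (Fin d))
        ∂μ := by
  have hpc := continuousOn_of_abs_sub_le_mul_norm hpL
  have hstar : θstar ∈ Θ := hball (Metric.mem_ball_self hr)
  rw [hp.integral_eq hΘ hpc ((Metric.ball θstar r).indicator fun _ => (1 : ℝ))]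
  have e : (fun x => (Metric.ball θstar r).indicator (fun _ => (1 : ℝ)) x * Θ.indicator p x) =
      (Metric.ball θstar r).indicator p := by
    funext x
    by_cases hx : x ∈ Metric.ball θstar r
    · simp [hx, hball hx]
    · simp [hx]
  have hvol : (volume (Metric.ball θstar r)).toReal =
      r ^ d * (volume (Metric.ball (0 : EuclideanSpace ℝ (Fin d)) 1)).toReal := by
    rw [Measure.addHaar_ball_of_pos _ _ hr, ENNReal.toReal_mul, finrank_euclideanSpace_fin,
      ENNReal.toReal_ofReal (by positivity)]
  rw [e, integral_indicator measurableSet_ball, ← hvol]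
  have hb : ∀ x ∈ Metric.ball θstar r, |p x - p θstar| ≤ p θstar / 2 := fun x hx =>
    (hpL x (hball hx) θstar hstar).trans (le_trans (mul_le_mul_of_nonneg_left
      (mem_ball_iff_norm.1 hx).le hL) hrL)
  have h_int : IntegrableOn p (Metric.ball θstar r) := by
    refine IntegrableOn.of_bound measure_ball_lt_top
      ((hpc.mono hball).aestronglyMeasurable measurableSet_ball) (p θstar * (3 / 2)) ?_
    filter_upwards [ae_restrict_mem measurableSet_ball] with x hx
    rw [Real.norm_of_nonneg (hp.1 x (hball hx))]
    linarith [(abs_le.1 (hb x hx)).2]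
  have h := setIntegral_mono_on (μ := volume) (f := fun _ => p θstar / 2) (g := p)
    (integrableOn_const measure_ball_lt_top.ne) h_int measurableSet_ball
    fun x hx => by linarith [(abs_le.1 (hb x hx)).1]
  rw [setIntegral_const, smul_eq_mul, mul_comm] at h
  exact h

/-! ### Bandwidth and grid -/

/-- For `u ≥ 1` the floor satisfies `⌊u⌋ ≤ u ≤ 2 * ⌊u⌋`. -/
theorem bandwidth_bounds {d N : ℕ} (hN : 1 ≤ N) :
    ((N : ℝ) ^ ((1 : ℝ) / (2 * ((d : ℝ) + 1))))⁻¹ ≤ bandwidth d N ∧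
      bandwidth d N ≤ 2 * ((N : ℝ) ^ ((1 : ℝ) / (2 * ((d : ℝ) + 1))))⁻¹ := by
  have hN' : (1 : ℝ) ≤ N := by exact_mod_cast hN
  set u := (N : ℝ) ^ ((1 : ℝ) / (2 * ((d : ℝ) + 1)))
  have hu : 1 ≤ u := Real.one_le_rpow hN' (by positivity)
  have h1 : (1 : ℝ) ≤ (⌊u⌋₊ : ℕ) := by exact_mod_cast Nat.one_le_floor_iff u |>.2 hu
  have h2 : ((⌊u⌋₊ : ℕ) : ℝ) ≤ u := Nat.floor_le (by linarith)
  have h3 := Nat.lt_floor_add_one u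
  unfold bandwidth
  constructor
  · gcongr
  · rw [← div_eq_mul_inv, inv_eq_one_div, div_le_div_iff₀ (by linarith) (by linarith)]
    linarith

theorem rpow_inv_pow_succ_eq_sqrt (d N : ℕ) :
    ((N : ℝ) ^ ((1 : ℝ) / (2 * ((d : ℝ) + 1)))) ^ (d + 1) = √(N : ℝ) := by
  rw [← Real.rpow_natCast, ← Real.rpow_mul (Nat.cast_nonneg N), Real.sqrt_eq_rpow]
  congr 1
  push_cast
  field_simp

/-- The points are the lattice points of mesh `1 / N` in a cube, and `θ` is rounded down
coordinatewise. The mesh is fine enough that rounding stays negligible after multiplication by `h ^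
(-(d + 1))`. -/
theorem exists_grid (d R : ℕ) {N : ℕ} (hN : 1 ≤ N) :
    ∃ Γ : Finset (EuclideanSpace ℝ (Fin d)), (Γ.card : ℝ) ≤ (2 * R + 1) ^ d * (N : ℝ) ^ d ∧
      ∀ θ : EuclideanSpace ℝ (Fin d), ‖θ‖ ≤ R → ∃ g ∈ Γ, ‖θ - g‖ ≤ d / N := by
  classical
  have hN' : (0 : ℝ) < N := by exact_mod_cast hN
  set point : (Fin d → ℤ) → EuclideanSpace ℝ (Fin d) :=
    fun z => WithLp.toLp 2 fun i => (z i : ℝ) / N with hpoint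
  refine ⟨(Fintype.piFinset fun _ : Fin d => Finset.Icc (-(R * N : ℤ)) (R * N)).image point,
    ?_, fun θ hθ => ⟨point fun i => ⌊θ i * N⌋, ?_, ?_⟩⟩
  · have h1 : ((Fintype.piFinset fun _ : Fin d => Finset.Icc (-(R * N : ℤ)) (R * N)).card : ℝ) =
        (2 * R * N + 1) ^ d := by
      rw [Fintype.card_piFinset_const, Int.card_Icc]
      have : ((R * N : ℤ) + 1 - -(R * N : ℤ)).toNat = 2 * R * N + 1 := by
        rw [show ((R * N : ℤ) + 1 - -(R * N : ℤ)) = ((2 * R * N + 1 : ℕ) : ℤ) by push_cast; ring,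
          Int.toNat_natCast]
      rw [this]
      push_cast
      ring
    calc _ ≤ ((Fintype.piFinset fun _ : Fin d =>
            Finset.Icc (-(R * N : ℤ)) (R * N)).card : ℝ) := by exact_mod_cast Finset.card_image_le
      _ = (2 * R * N + 1) ^ d := h1
      _ ≤ _ := by
        rw [← mul_pow]
        gcongr
        have : (1 : ℝ) ≤ N := by exact_mod_cast hN
        linarith
  · refine Finset.mem_image_of_mem _ (Fintype.mem_piFinset.2 fun i => ?_)
    have h1 : |θ i| ≤ R := (by simpa using PiLp.norm_apply_le θ i : |θ i| ≤ ‖θ‖).trans hθ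
    have h2 := abs_le.1 h1
    rw [Finset.mem_Icc, Int.le_floor, Int.floor_le_iff]
    push_cast
    constructor <;> nlinarith
  · have hcoord : ∀ i, |θ i - point (fun i => ⌊θ i * N⌋) i| ≤ 1 / N := by
      intro i
      have e : point (fun i => ⌊θ i * N⌋) i = (⌊θ i * N⌋ : ℝ) / N := rfl
      rw [e, show θ i - (⌊θ i * N⌋ : ℝ) / N = (θ i * N - ⌊θ i * N⌋) / N by field_simp, abs_div,
        abs_of_pos hN']
      gcongr
      rw [abs_le]
      constructor <;> linarith [Int.floor_le (θ i * N), Int.lt_floor_add_one (θ i * N)]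
    set v := θ - point fun i => ⌊θ i * N⌋ with hv
    have e : ∑ i, v i • EuclideanSpace.single i (1 : ℝ) = v := by
      ext j
      simp [Finset.sum_apply, Pi.single_apply]
    rw [← e]
    calc _ ≤ ∑ i, ‖v i • EuclideanSpace.single i (1 : ℝ)‖ := norm_sum_le _ _
      _ ≤ ∑ i : Fin d, 1 / (N : ℝ) := Finset.sum_le_sum fun i _ => by
          simpa [norm_smul, hv] using hcoord i
      _ = d / N := by simp [div_eq_mul_inv]

/-! ### Exceptional events and the random constant -/

/-- The event that some empirical average of a test function `f j`, `j ∈ s`, has an error of at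
least `N ^ δ / √N`. -/
def deviationEvent {S Ω I : Type*} [MeasurableSpace S] {N : ℕ} (Z : Fin N → Ω → S)
    (μ : Measure S) (δ : ℝ) (s : Finset I) (f : I → S → ℝ) : Set Ω :=
  ⋃ j ∈ s, {ω | (N : ℝ) ^ δ / √(N : ℝ) ≤ |1 / (N : ℝ) * ∑ i, f j (Z i ω) - ∫ x, f j x ∂μ|}

theorem measurableSet_deviationEvent {S Ω I : Type*} [MeasurableSpace S] [MeasurableSpace Ω]
    {N : ℕ} {Z : Fin N → Ω → S} (hZ : ∀ i, Measurable (Z i)) (μ : Measure S) (δ : ℝ)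
    (s : Finset I) {f : I → S → ℝ} (hf : ∀ j, Measurable (f j)) :
    MeasurableSet (deviationEvent Z μ δ s f) := by
  refine Finset.measurableSet_biUnion _ fun j _ => measurableSet_le measurable_const ?_
  exact (((Finset.measurable_sum _ fun i _ => (hf j).comp (hZ i)).const_mul _).sub_const _).abs

/-- The tail bound is used at `s = N ^ δ`, with its order `m` so large that `2 * m * δ ≥ a + 3`: the
union over `O(N ^ a)` functions then still leaves `N ^ (-3)`. -/
theorem HasEmpiricalTails.exists_deviationEvent_le {S Ω I : Type*} [MeasurableSpace S]
    [MeasurableSpace Ω] {P : Measure Ω} {Z : (N : ℕ) → Fin N → Ω → S} {μ : Measure S}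
    (h : HasEmpiricalTails P Z μ) {δ : ℝ} (hδ : 0 < δ) (a : ℕ) {K : ℝ} {s : ℕ → Finset I}
    (hs : ∀ N, 1 ≤ N → ((s N).card : ℝ) ≤ K * (N : ℝ) ^ a) {f : ℕ → I → S → ℝ}
    (hf : ∀ N j, Measurable (f N j)) (hf1 : ∀ N j x, |f N j x| ≤ 1) :
    ∃ C : ℝ, ∀ N, 1 ≤ N → P.real (deviationEvent (Z N) μ δ (s N) (f N)) ≤ C / (N : ℝ) ^ 3 := by
  obtain ⟨m, hm⟩ := exists_nat_ge ((a + 3 : ℝ) / (2 * δ))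
  obtain ⟨C, hC0, hC⟩ := h m
  refine ⟨K * C, fun N hN => ?_⟩
  have hN' : (1 : ℝ) ≤ N := by exact_mod_cast hN
  have hpow : (N : ℝ) ^ (a + 3) ≤ ((N : ℝ) ^ δ) ^ (2 * m) := by
    rw [← Real.rpow_natCast, ← Real.rpow_natCast, ← Real.rpow_mul (by positivity)]
    refine Real.rpow_le_rpow_of_exponent_le hN' ?_
    rw [div_le_iff₀ (by positivity)] at hm
    push_cast
    linarith
  calc _ ≤ ∑ j ∈ s N, P.real {ω | (N : ℝ) ^ δ / √(N : ℝ) ≤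
          |1 / (N : ℝ) * ∑ i, f N j (Z N i ω) - ∫ x, f N j x ∂μ|} :=
        measureReal_biUnion_finset_le _ _
    _ ≤ ∑ j ∈ s N, C / (N : ℝ) ^ (a + 3) := by
        refine Finset.sum_le_sum fun j _ => (hC N hN (f N j) (hf N j) (hf1 N j) _
          (by positivity)).trans ?_
        gcongr
    _ = (s N).card * (C / (N : ℝ) ^ (a + 3)) := by simp
    _ ≤ K * (N : ℝ) ^ a * (C / (N : ℝ) ^ (a + 3)) := by gcongr; exact hs N hN
    _ = _ := by rw [pow_add]; field_simp

/-- If `P (A N)` is of order `N⁻³`, then a single finite random variable dominates `M N ^ β` on all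
the events `A N`. -/
theorem exists_random_bound {Ω : Type*} [MeasurableSpace Ω] (P : Measure Ω)
    [IsProbabilityMeasure P] {A : ℕ → Set Ω} (hA : ∀ N, 1 ≤ N → MeasurableSet (A N)) {C : ℝ}
    (hC : ∀ N, 1 ≤ N → P.real (A N) ≤ C / (N : ℝ) ^ 3) {M β : ℝ} (hM : 0 ≤ M) (hβ : β ≤ 1) :
    ∃ W : Ω → ℝ, Measurable W ∧ (∀ ω, 0 ≤ W ω) ∧
      ∀ᵐ ω ∂P, ∀ N, 1 ≤ N → ω ∈ A N → M ≤ W ω / (N : ℝ) ^ β := by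
  -- The bound is the sum of all values `M * N ^ β` over the events that occur, with `N = n + 1`. As
  -- `β ≤ 1`, its mean is at most `M * C * ∑ N ^ (-2)`, so it is almost surely finite.
  set F : ℕ → Ω → ℝ≥0∞ := fun n =>
    (A (n + 1)).indicator fun _ => ENNReal.ofReal (M * ((n + 1 : ℕ) : ℝ) ^ β) with hF
  have hFm : ∀ n, Measurable (F n) := fun n => measurable_const.indicator (hA (n + 1) (by omega))
  have hsum : Measurable fun ω => ∑' n, F n ω := Measurable.tsum hFm
  have hfin : ∫⁻ ω, ∑' n, F n ω ∂P ≠ ∞ := by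
    rw [lintegral_tsum fun n => (hFm n).aemeasurable]
    have hle : ∀ n, ∫⁻ ω, F n ω ∂P ≤ ENNReal.ofReal (M * C * (((n + 1 : ℕ) : ℝ) ^ 2)⁻¹) := by
      intro n
      have hn : (1 : ℝ) ≤ ((n + 1 : ℕ) : ℝ) := by push_cast; linarith [Nat.cast_nonneg (α := ℝ) n]
      rw [hF, lintegral_indicator_const (hA (n + 1) (by omega)), ← ofReal_measureReal,
        ← ENNReal.ofReal_mul (by positivity)]
      refine ENNReal.ofReal_le_ofReal ?_
      have h1 : ((n + 1 : ℕ) : ℝ) ^ β ≤ ((n + 1 : ℕ) : ℝ) := by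
        simpa using Real.rpow_le_rpow_of_exponent_le hn hβ
      calc _ ≤ M * ((n + 1 : ℕ) : ℝ) * (C / ((n + 1 : ℕ) : ℝ) ^ 3) := by
            gcongr
            exact hC (n + 1) (by omega)
        _ = _ := by field_simp
    refine ne_of_lt ((ENNReal.tsum_le_tsum hle).trans_lt ?_)
    refine lt_of_le_of_ne le_top (Summable.tsum_ofReal_ne_top ?_)
    exact ((summable_nat_add_iff 1).2 (Real.summable_nat_pow_inv.2 one_lt_two)).mul_left _
  refine ⟨fun ω => (∑' n, F n ω).toReal, hsum.ennreal_toReal, fun ω => ENNReal.toReal_nonneg, ?_⟩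
  filter_upwards [ae_lt_top hsum hfin] with ω hω N hN hωN
  have hN' : (0 : ℝ) < N := by exact_mod_cast hN
  rw [le_div_iff₀ (by positivity)]
  obtain ⟨n, rfl⟩ : ∃ n, N = n + 1 := ⟨N - 1, by omega⟩
  rw [← ENNReal.ofReal_le_iff_le_toReal hω.ne]
  refine le_trans (le_of_eq ?_) (ENNReal.le_tsum n)
  rw [hF]
  simp only
  rw [Set.indicator_of_mem hωN]

/-! ### Uniform error of the estimator and comparison at its maximizer -/

/-- Control of a kernel density estimator on a grid extends to all points. -/
theorem abs_particleKDE_sub_le {d N : ℕ} (hN : 1 ≤ N) {Θ : Set (EuclideanSpace ℝ (Fin d))}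
    {μ : Measure Θ} [IsProbabilityMeasure μ] {k : EuclideanSpace ℝ (Fin d) → ℝ} {B : ℝ}
    (hB : 0 < B) (hkB : ∀ x, |k x| ≤ B) (hkL : ∀ x y, |k x - k y| ≤ B * ‖x - y‖)
    {q u : ℝ} (hq : 1 ≤ q) (hu : 1 ≤ u) (huN : u ^ (d + 1) = √(N : ℝ))
    (hh : 0 < bandwidth d N) (hhu : (bandwidth d N)⁻¹ ≤ u) (x : Fin N → Θ)
    {θ g : EuclideanSpace ℝ (Fin d)} (hg : ‖θ - g‖ ≤ d / N)
    (hgood : |1 / (N : ℝ) * ∑ i, k ((bandwidth d N)⁻¹ • (g - x i)) / B -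
      ∫ x : Θ, k ((bandwidth d N)⁻¹ • (g - x)) / B ∂μ| < q / √(N : ℝ)) :
    |particleKDE k (fun l => (x l : EuclideanSpace ℝ (Fin d))) θ -
      ∫ x : Θ, scaledKernel k (bandwidth d N) (θ - x) ∂μ| ≤ (B + 2 * B * d) * (q / u) := by
  have hN' : (0 : ℝ) < N := by exact_mod_cast hN
  set h := bandwidth d N
  have hkc : Continuous k := continuousOn_univ.1
    (continuousOn_of_abs_sub_le_mul_norm fun x _ y _ => hkL x y)
  have h_int : ∀ θ : EuclideanSpace ℝ (Fin d), Integrable (fun x : Θ => k (h⁻¹ • (θ - x))) μ :=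
    fun θ => Integrable.of_bound
      (hkc.comp (by fun_prop)).aestronglyMeasurable B (ae_of_all _ fun x => hkB _)
  -- The cost of moving from `θ` to the grid point `g`, paid once in the average and once in the
  -- integral.
  set η : ℝ := B * (u * (d / N)) with hη
  have hclose : ∀ z : EuclideanSpace ℝ (Fin d),
      |k (h⁻¹ • (θ - z)) - k (h⁻¹ • (g - z))| ≤ η := by
    intro z
    refine (hkL _ _).trans ?_
    rw [← smul_sub, sub_sub_sub_cancel_right, norm_smul, Real.norm_of_nonneg (by positivity),
      hη]
    gcongr
  set E₁ := 1 / (N : ℝ) * ∑ i, k (h⁻¹ • (θ - x i))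
  set E₂ := 1 / (N : ℝ) * ∑ i, k (h⁻¹ • (g - x i))
  set I₁ := ∫ x : Θ, k (h⁻¹ • (θ - x)) ∂μ
  set I₂ := ∫ x : Θ, k (h⁻¹ • (g - x)) ∂μ
  have hE : |E₁ - E₂| ≤ η := by
    simp only [E₁, E₂]
    rw [← mul_sub, ← Finset.sum_sub_distrib, abs_mul, abs_of_pos (by positivity)]
    calc _ ≤ 1 / (N : ℝ) * ∑ i : Fin N, η := by
          gcongr
          exact (Finset.abs_sum_le_sum_abs _ _).trans (Finset.sum_le_sum fun i _ => hclose _)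
      _ = η := by
          simp only [Finset.sum_const, Finset.card_univ, Fintype.card_fin, nsmul_eq_mul]
          field_simp
  have hI : |I₁ - I₂| ≤ η := by
    simp only [I₁, I₂]
    rw [← integral_sub (h_int θ) (h_int g)]
    have := norm_integral_le_of_norm_le_const (μ := μ) (C := η)
      (f := fun x : Θ => k (h⁻¹ • (θ - x)) - k (h⁻¹ • (g - x))) (ae_of_all _ fun x => hclose x)
    simpa using this
  have hEI : |E₂ - I₂| ≤ B * (q / √(N : ℝ)) := by
    rw [← Finset.sum_div, integral_div, ← mul_div_assoc, ← sub_div, abs_div, abs_of_pos hB,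
      div_lt_iff₀ hB] at hgood
    linarith
  have hKDE : particleKDE k (fun l => (x l : EuclideanSpace ℝ (Fin d))) θ = (h ^ d)⁻¹ * E₁ := by
    simp only [particleKDE, scaledKernel, E₁, ← Finset.mul_sum]
    ring
  have hInt : ∫ x : Θ, scaledKernel k h (θ - x) ∂μ = (h ^ d)⁻¹ * I₁ := by
    simp only [scaledKernel, I₁, integral_const_mul]
  rw [hKDE, hInt, ← mul_sub, abs_mul, abs_of_pos (by positivity)]
  have h1 : |E₁ - I₁| ≤ B * (q / √(N : ℝ)) + 2 * η := by
    rw [show E₁ - I₁ = (E₁ - E₂) + (E₂ - I₂) + (I₂ - I₁) by ring]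
    have := abs_sub_comm I₁ I₂
    linarith [abs_add_le ((E₁ - E₂) + (E₂ - I₂)) (I₂ - I₁), abs_add_le (E₁ - E₂) (E₂ - I₂)]
  have h2 : (h ^ d)⁻¹ ≤ u ^ d := by
    rw [← inv_pow]
    gcongr
  have hsq : (N : ℝ) = u ^ (d + 1) * u ^ (d + 1) := by
    rw [huN, Real.mul_self_sqrt hN'.le]
  have hη0 : 0 ≤ η := by positivity
  -- Both terms use `√N = u ^ (d + 1)`: the stochastic one becomes `B * q / u`, and the grid one `u
  -- ^ d * u / N = u ^ (-(d + 1))` up to a constant, which is smaller.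
  calc (h ^ d)⁻¹ * |E₁ - I₁| ≤ u ^ d * (B * (q / √(N : ℝ)) + 2 * η) := by gcongr
    _ = B * (q / u) + 2 * B * d * (1 / u ^ (d + 1)) := by
        rw [hη, ← huN, hsq]
        field_simp
        ring
    _ ≤ B * (q / u) + 2 * B * d * (q / u) := by
        gcongr
        exact le_self_pow₀ hu (by omega)
    _ = _ := by ring

/-- A uniformly accurate density estimator that is evaluated at a point near the mode of the true
density has its maximizers near the mode, in terms of the value of the true density. -/
theorem sub_le_of_isMax_particleKDE {d N : ℕ} {Θ : Set (EuclideanSpace ℝ (Fin d))}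
    (hΘ : MeasurableSet Θ) {μ : Measure Θ} {p : EuclideanSpace ℝ (Fin d) → ℝ}
    (hp : IsLebesgueDensity μ p) {L : ℝ} (hL : 0 ≤ L)
    (hpL : ∀ x ∈ Θ, ∀ y ∈ Θ, |p x - p y| ≤ L * ‖x - y‖)
    {k : EuclideanSpace ℝ (Fin d) → ℝ} (hk : IsRegularKernel k) (hh : 0 < bandwidth d N)
    {θstar : EuclideanSpace ℝ (Fin d)} {r₀ : ℝ} (hr₀ : 0 < r₀)
    (hball : Metric.ball θstar r₀ ⊆ Θ) (hmax : IsMaxOn p Θ θstar) (x : Fin N → Θ) {η r : ℝ}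
    (herr : ∀ θ ∈ Θ, |particleKDE k (fun l => (x l : EuclideanSpace ℝ (Fin d))) θ -
      ∫ x : Θ, scaledKernel k (bandwidth d N) (θ - x) ∂μ| ≤ η)
    (hr : r ≤ r₀ / 2) {j : Fin N} (hj : ‖(x j : EuclideanSpace ℝ (Fin d)) - θstar‖ < r)
    {i : Fin N} (hij : particleKDE k (fun l => (x l : EuclideanSpace ℝ (Fin d))) (x j) ≤
      particleKDE k (fun l => (x l : EuclideanSpace ℝ (Fin d))) (x i)) :
    p θstar - p (x i) ≤
      2 * η + (2 * L + 2 * p θstar / r₀) * bandwidth d N * (∫ x, ‖x‖ * k x) + L * r := by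
  -- The estimate is compared with its mean at both particles. The upper bias bound is used at the
  -- maximizer `x i`, which may be near the boundary; the lower one only at `x j`, which is near the
  -- mode.
  have h1 := abs_le.1 (herr _ (x i).2)
  have h2 := abs_le.1 (herr _ (x j).2)
  have h3 := integral_scaledKernel_le hΘ hp hL hpL hk hh (x i).2
  have h4 := le_integral_scaledKernel hΘ hp hL hpL hk hh (x j).2
    (sub_mul_norm_le_indicator hL hr₀ hp.1 hpL hball hmax (hj.trans_le hr))
  have h5 := hpL θstar (hball (Metric.mem_ball_self hr₀)) (x j) (x j).2
  rw [norm_sub_rev] at h5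
  have h6 : L * ‖(x j : EuclideanSpace ℝ (Fin d)) - θstar‖ ≤ L * r := by gcongr
  linarith [le_abs_self (p θstar - p (x j)), h1.1, h1.2, h2.1, h2.2]

theorem exists_mem_of_abs_average_indicator_sub_lt {S : Type*} {N : ℕ} {b : Set S} {x : Fin N → S}
    {c e : ℝ} (hec : e ≤ c)
    (h : |1 / (N : ℝ) * ∑ i, b.indicator (fun _ => (1 : ℝ)) (x i) - c| < e) : ∃ j, x j ∈ b := by
  by_contra! hcon
  have : ∑ i, b.indicator (fun _ => (1 : ℝ)) (x i) = 0 :=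
    Finset.sum_eq_zero fun i _ => Set.indicator_of_notMem (hcon i) _
  rw [this, mul_zero, zero_sub, abs_neg] at h
  linarith [le_abs_self c]

/-! ### The main theorem -/

theorem mainTheorem1 {d T : ℕ} {Θ : Set (EuclideanSpace ℝ (Fin d))} (hΘ : IsCompact Θ)
    {Ω : Type*} [MeasurableSpace Ω] (P : Measure Ω) [IsProbabilityMeasure P]
    -- prior, potentials, jittering kernels
    (π₀ : Measure Θ) [IsProbabilityMeasure π₀]
    (G : ℕ → Θ → ℝ) (hG : PositiveBoundedPotentials G T)
    (κ : ℕ → Kernel Θ Θ) [∀ N, IsMarkovKernel (κ N)] (hκ : JitterBound κ)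
    -- the densities of `π_1, …, π_T`
    (p : ℕ → EuclideanSpace ℝ (Fin d) → ℝ)
    (hp : ∀ t, 1 ≤ t → t ≤ T → IsLebesgueDensity (potentialFlow π₀ G t) (p t))
    (hpLip : ∀ t, 1 ≤ t → t ≤ T → HasLipschitzMixedPartials Θ (p t))
    -- the kernel of the density estimator
    (k : EuclideanSpace ℝ (Fin d) → ℝ) (hk : IsRegularKernel k)
    -- for every `N ≥ 1`, an `N`-particle system, all of them on the same probability space
    (X Y : (N : ℕ) → ℕ → Fin N → Ω → Θ)
    (hX : ∀ N, 1 ≤ N → IsParticleSystem P π₀ (κ N) G T N (X N) (Y N)) :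
    ∀ t, 1 ≤ t → t ≤ T →
      ∀ θstar ∈ interior Θ, IsMaxOn (p t) Θ θstar →
      ∀ ε : ℝ, 0 < ε → ε < 1 →
      ∃ W : Ω → ℝ, Measurable W ∧ ∃ N₀ : ℕ, ∀ᵐ ω ∂P, ∀ N ≥ N₀, ∀ i : Fin N,
        (∀ j : Fin N,
          particleKDE k (fun l => (X N t l ω : EuclideanSpace ℝ (Fin d))) (X N t j ω) ≤
            particleKDE k (fun l => (X N t l ω : EuclideanSpace ℝ (Fin d))) (X N t i ω)) →
        p t θstar - p t (X N t i ω) ≤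
          W ω / (N : ℝ) ^ ((1 - ε) / (2 * ((d : ℝ) + 1))) := by
  intro t ht htT θstar hstar hmax ε hε hε1
  replace hp := hp t ht htT
  obtain ⟨L, hL, hpL⟩ := (hpLip t ht htT).exists_lipschitz
  have := isProbabilityMeasure_potentialFlow (π₀ := π₀) hG t htT
  have htails := hasEmpiricalTails_potentialFlow hκ hG hX t htT
  set μ := potentialFlow π₀ G t
  set p := p t
  have hstarΘ : θstar ∈ Θ := interior_subset hstar
  -- A zero maximum makes the claim trivial; below, positivity gives the ball about the mode its
  -- mass.
  rcases (hp.1 θstar hstarΘ).eq_or_lt with hzero | hpos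
  · refine ⟨0, measurable_const, 0, ae_of_all _ fun ω N _ i _ => ?_⟩
    rw [← hzero, Pi.zero_apply, zero_div, zero_sub, neg_nonpos]
    exact hp.1 _ (X N t i ω).2
  have hΘm : MeasurableSet Θ := hΘ.measurableSet
  obtain ⟨r₀, hr₀, hball⟩ := Metric.isOpen_iff.1 isOpen_interior θstar hstar
  replace hball : Metric.ball θstar r₀ ⊆ Θ := hball.trans interior_subset
  obtain ⟨B, hB, hkB, hkL⟩ := hk.exists_bound_lipschitz
  have hkc : Continuous k := continuousOn_univ.1
    (continuousOn_of_abs_sub_le_mul_norm fun x _ y _ => hkL x y)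
  obtain ⟨R₁, hR₁⟩ := hΘ.isBounded.exists_norm_le
  obtain ⟨R, hR⟩ := exists_nat_ge R₁
  set ρ : ℝ := 1 / (2 * ((d : ℝ) + 1)) with hρ
  have hρ0 : 0 < ρ := by positivity
  have hρ1 : ρ ≤ 1 := by
    rw [hρ, div_le_one (by positivity)]
    linarith [Nat.cast_nonneg (α := ℝ) d]
  set β : ℝ := (1 - ε) / (2 * ((d : ℝ) + 1)) with hβ
  have hβρ : β = (1 - ε) * ρ := by rw [hβ, hρ]; ring
  have hβ0 : 0 < β := by rw [hβρ]; exact mul_pos (by linarith) hρ0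
  have hβ1 : β ≤ 1 := by rw [hβρ]; nlinarith
  set δ : ℝ := ε * ρ
  have hδ : 0 < δ := by positivity
  set rad : ℕ → ℝ := fun N => ((N : ℝ) ^ β)⁻¹ with hrad
  have hquot : ∀ N : ℕ, 1 ≤ N → (N : ℝ) ^ δ / (N : ℝ) ^ ρ = rad N := by
    intro N hN
    have hN' : (0 : ℝ) < N := by exact_mod_cast hN
    change _ = ((N : ℝ) ^ β)⁻¹
    rw [← Real.rpow_sub hN', ← Real.rpow_neg hN'.le]
    congr 1
    rw [hβρ]
    ring
  -- Indexing by `N + 1` avoids the empty system; the shift is undone in `grid`.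
  choose Γ hΓcard hΓ using fun N : ℕ => exists_grid d R (N := N + 1) (by omega)
  set grid : ℕ → Finset (EuclideanSpace ℝ (Fin d)) := fun N => Γ (N - 1)
  set f₁ : ℕ → EuclideanSpace ℝ (Fin d) → Θ → ℝ :=
    fun N g x => k ((bandwidth d N)⁻¹ • (g - x)) / B with hf₁
  set f₂ : ℕ → Unit → Θ → ℝ := fun N _ x =>
    (Metric.ball θstar (rad N)).indicator (fun _ => (1 : ℝ)) (x : EuclideanSpace ℝ (Fin d)) with hf₂
  have hf₁m : ∀ N g, Measurable (f₁ N g) := fun N g =>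
    ((hkc.comp (by fun_prop)).div_const B).measurable
  have hf₂m : ∀ N j, Measurable (f₂ N j) := fun N j =>
    (measurable_const.indicator measurableSet_ball).comp measurable_subtype_coe
  obtain ⟨C₁, hC₁⟩ := htails.exists_deviationEvent_le hδ d (K := (2 * R + 1) ^ d) (s := grid)
    (fun N hN => by
      have := hΓcard (N - 1)
      rwa [Nat.sub_add_cancel hN] at this) hf₁m
    (fun N g x => by
      rw [hf₁, abs_div, abs_of_pos hB, div_le_one hB]
      exact hkB _)
  obtain ⟨C₂, hC₂⟩ := htails.exists_deviationEvent_le hδ 0 (K := 1) (s := fun _ => {()})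
    (fun N hN => by simp) hf₂m
    (fun N j x => by
      simp only [hf₂, Set.indicator]
      split_ifs <;> simp)
  set A : ℕ → Set Ω := fun N => deviationEvent (X N t) μ δ (grid N) (f₁ N) ∪
    deviationEvent (X N t) μ δ {()} (f₂ N) with hA
  -- `M = p θstar` bounds the gap trivially, so on `A N` nothing else is needed.
  obtain ⟨W, hWm, hW0, hW⟩ := exists_random_bound P (A := A) (C := C₁ + C₂) (M := p θstar) (β := β)
    (fun N hN => (measurableSet_deviationEvent ((hX N hN).measurable_X t) μ δ _ (hf₁m N)).union
      (measurableSet_deviationEvent ((hX N hN).measurable_X t) μ δ _ (hf₂m N)))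
    (fun N hN => (measureReal_union_le _ _).trans <| by
      rw [add_div]
      exact add_le_add (hC₁ N hN) (hC₂ N hN)) hpos.le hβ1
  set v := (volume (Metric.ball (0 : EuclideanSpace ℝ (Fin d)) 1)).toReal with hv
  have hv0 : 0 < v := ENNReal.toReal_pos (Metric.measure_ball_pos _ _ one_pos).ne'
    measure_ball_lt_top.ne
  set c := p θstar / 2 * v
  have hc : 0 < c := by positivity
  have hradlim : Tendsto rad atTop (nhds 0) :=
    (tendsto_rpow_atTop hβ0).comp tendsto_natCast_atTop_atTop |>.inv_tendsto_atTop
  -- The three conditions keep the ball well inside `Θ`, keep the density above `p θstar / 2` on it,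
  -- and make its mass at least the deviation `q / √N`.
  obtain ⟨N₀, hN₀⟩ := eventually_atTop.1 (((hradlim.eventually_le_const (half_pos hr₀)).and
    (hradlim.eventually_le_const (show 0 < p θstar / 2 / L by positivity))).and
    (hradlim.eventually_le_const hc))
  set M₁ := ∫ x, ‖x‖ * k x
  have hM₁ : 0 ≤ M₁ := integral_nonneg fun x => mul_nonneg (norm_nonneg _) (hk.nonneg _)
  set C₀ : ℝ := 2 * (B + 2 * B * d) + (2 * L + 2 * p θstar / r₀) * 2 * M₁ + L with hC₀
  refine ⟨fun ω => C₀ + W ω, measurable_const.add hWm, max N₀ 1, ?_⟩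
  filter_upwards [hW] with ω hω N hN i hi
  have hN1 : 1 ≤ N := le_of_max_le_right hN
  have hN' : (1 : ℝ) ≤ N := by exact_mod_cast hN1
  have hNβ : 0 < (N : ℝ) ^ β := by positivity
  rw [add_div]
  by_cases hωA : ω ∈ A N
  · have h1 := hω N hN1 hωA
    have h2 : 0 ≤ C₀ / (N : ℝ) ^ β := by positivity
    have h3 := hp.1 _ (X N t i ω).2
    linarith
  obtain ⟨⟨hr1, hr2⟩, hr3⟩ := hN₀ N (le_of_max_le_left hN)
  simp only [hA, deviationEvent, Set.mem_union, Set.mem_iUnion, Set.mem_ofPred_eq, not_or,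
    not_exists, not_le] at hωA
  obtain ⟨hg₁, hg₂⟩ := hωA
  set u := (N : ℝ) ^ ρ
  set q := (N : ℝ) ^ δ
  have hu : 1 ≤ u := Real.one_le_rpow hN' hρ0.le
  have hq : 1 ≤ q := Real.one_le_rpow hN' hδ.le
  have hqu : q / u = rad N := hquot N hN1
  have huN : u ^ (d + 1) = √(N : ℝ) := rpow_inv_pow_succ_eq_sqrt d N
  obtain ⟨hb1, hb2⟩ := bandwidth_bounds (d := d) hN1
  have hh : 0 < bandwidth d N := lt_of_lt_of_le (by positivity) hb1
  have hhu : (bandwidth d N)⁻¹ ≤ u := inv_le_of_inv_le₀ (by positivity) hb1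
  have hrad0 : 0 < rad N := by positivity
  have hmass := le_integral_indicator_ball hΘm hp hL.le hpL hrad0
    ((Metric.ball_subset_ball (by linarith)).trans hball)
    (by rwa [le_div_iff₀' hL] at hr2)
  -- The deviation equals `rad N * u ^ (-d)`, whereas the mass is at least `c * (q / u) ^ d`; `q ≥
  -- 1` and `rad N ≤ c` suffice.
  have hqN : q / √(N : ℝ) ≤ p θstar / 2 * (rad N ^ d * v) := by
    calc q / √(N : ℝ) = rad N * (1 / u ^ d) := by
          rw [← huN, ← hqu, pow_succ]
          field_simp
      _ ≤ c * (q / u) ^ d := by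
          rw [div_pow]
          gcongr
          exact one_le_pow₀ hq
      _ = _ := by rw [hqu]; ring
  obtain ⟨j, hj⟩ := exists_mem_of_abs_average_indicator_sub_lt
    (x := fun l => (X N t l ω : EuclideanSpace ℝ (Fin d))) (hqN.trans hmass)
    (hg₂ () (Finset.mem_singleton_self _))
  have herr : ∀ θ ∈ Θ, |particleKDE k (fun l => (X N t l ω : EuclideanSpace ℝ (Fin d))) θ -
      ∫ x : Θ, scaledKernel k (bandwidth d N) (θ - x) ∂μ| ≤ (B + 2 * B * d) * (q / u) := by
    intro θ hθ
    obtain ⟨g, hgΓ, hg⟩ := hΓ (N - 1) θ ((hR₁ θ hθ).trans hR)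
    rw [Nat.sub_add_cancel hN1] at hg
    exact abs_particleKDE_sub_le hN1 hB hkB hkL hq hu huN hh hhu (fun l => X N t l ω) hg
      (hg₁ g hgΓ)
  have hfinal := sub_le_of_isMax_particleKDE hΘm hp hL.le hpL hk hh hr₀ hball hmax
    (fun l => X N t l ω) herr hr1 (mem_ball_iff_norm.1 hj) (hi j)
  refine hfinal.trans ?_
  have hb3 : bandwidth d N ≤ 2 * rad N := by
    refine hb2.trans ?_
    rw [← hqu, div_eq_mul_inv]
    gcongr
    exact le_mul_of_one_le_left (by positivity) hq
  have h2 : 0 ≤ W ω / (N : ℝ) ^ β := div_nonneg (hW0 ω) hNβ.le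
  calc _ ≤ 2 * ((B + 2 * B * d) * rad N) +
        (2 * L + 2 * p θstar / r₀) * (2 * rad N) * M₁ + L * rad N := by
        rw [hqu]
        gcongr
    _ = C₀ / (N : ℝ) ^ β := by rw [hC₀, hrad]; ring
    _ ≤ _ := by linarith
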